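/- Let $d,r\ge 1$ be integers, $0<p\le\infty$ and $L>1$. Then there is a constant $C=C(p,d,r,L)$, depending only on $p,d,r,L$, with the following property. Let $D\subset\mathbb R^d$ be a compact (nondegenerate) parallelepiped, let $g_1,g_2:D\to\mathbb R$ be functions such that $$G:=\{(x,y)\in\mathbb R^{d}\times\mathbb R:\ x\in D,\ g_1(x)\le y\le g_2(x)\}$$ is Lebesgue measurable, and suppose that there are an affine function $H:\mathbb R^d\to\mathbb R$ and a number $\delta>0$ such that $$\delta\le(-1)^i\bigl(g_i(x)-H(x)\bigr)\le L\delta\qquad\text{for all }x\in D,\ i=1,2,$$ so that $S\subset G\subset S_L$, where $S:=\{(x,y): x\in D,\ |y-H(x)|\le\delta\}$ and $S_L:=\{(x,y): x\in D,\ |y-H(x)|\le L\delta\}$. Let $e_{d+1}=(0,\dots,0,1)\in\mathbb R^{d+1}$, and let $\mathcal E\subset\mathbb S^d$ be the set of directions (unit vectors) of the edges of the $d$-dimensional parallelepiped $\{(x,H(x)):x\in D\}\subset\mathbb R^{d+1}$, that is, the edge directions of $D$ lifted to the graph of $H$; thus $\mathcal E\cup\{e_{d+1}\}$ is the set of edge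 directions of $S$ (up to sign), and for constant $H$ the set $\mathcal E$ consists of the edge directions of $D$. Then for every $f\in L^p(G)$, $$E_{r-1}(f;\mathcal E\cup\{e_{d+1}\})_{L^p(G)}\le C\Bigl[\omega^r(f,S;\mathcal E)_p+\omega^r(f,G;\{e_{d+1}\})_p\Bigr].$$ Here $L^p(\Omega)$ is taken with respect to Lebesgue measure (a quasi-normed space if $p<1$), with the convention that $L^\infty(\Omega)=C(\Omega)$ is the space of continuous functions with the uniform norm. For a set of directions $\mathcal F\subset\mathbb S^d$ and a bounded set $\Omega\subset\mathbb R^{d+1}$, $$\omega^r(f,\Omega;\mathcal F)_p:=\sup_{\xi\in\mathcal F}\ \sup_{0<u\le\operatorname{diam}\Omega}\bigl\|\triangle^r_{u\xi}(f,\Omega,\cdot)\bigr\|_{L^p(\Omega)},$$ where $\triangle_\xi^r(f,\Omega,\eta):=\sum_{j=0}^r(-1)^{r+j}\binom rj f(\eta+j\xi)$ if the segment $[\eta,\eta+r\xi]$ is contained in $\Omega$, and $\triangle_\xi^r(f,\Omega,\eta):=0$ otherwise. Finally, $$E_{r-1}(f;\mathcal F)_{L^p(\Omega)}:=\inf_Q\|f-Q\|_{L^p(\Omega)},$$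 the infimum being over all real polynomials $Q$ on $\mathbb R^{d+1}$ such that for all $x\in\mathbb R^{d+1}$ and $e\in\mathcal F$ the function $t\mapsto Q(x+te)$ is a polynomial of degree $<r$. -/

import Mathlib

open MeasureTheory Set
open scoped ENNReal NNReal

noncomputable section

namespace GraphWhitney

/-- The point `(x, y)` of `ℝ^(d+1)` with `x ∈ ℝ^d` and `y ∈ ℝ`. -/
def pt {d : ℕ} (x : EuclideanSpace ℝ (Fin d)) (y : ℝ) : EuclideanSpace ℝ (Fin (d + 1)) :=
  WithLp.toLp 2 (Fin.snoc (α := fun _ => ℝ) x.ofLp y)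

/-- The component `x ∈ ℝ^d` of a point `z = (x, y)` of `ℝ^(d+1)`. -/
def base {d : ℕ} (z : EuclideanSpace ℝ (Fin (d + 1))) : EuclideanSpace ℝ (Fin d) :=
  WithLp.toLp 2 (fun i => z i.castSucc)

/-- The component `y ∈ ℝ` of a point `z = (x, y)` of `ℝ^(d+1)`. -/
def height {d : ℕ} (z : EuclideanSpace ℝ (Fin (d + 1))) : ℝ := z (Fin.last d)

/-- The last standard basis vector `e_{d+1}` of `ℝ^(d+1)`. -/
def eLast (d : ℕ) : EuclideanSpace ℝ (Fin (d + 1)) := EuclideanSpace.single (Fin.last d) 1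

/-- The compact parallelepiped `{x₀ + ∑ tᵢ vᵢ : 0 ≤ tᵢ ≤ 1}` with vertex `x₀` and edge vectors
`vᵢ`. -/
def pped {d : ℕ} (x₀ : EuclideanSpace ℝ (Fin d)) (v : Fin d → EuclideanSpace ℝ (Fin d)) :
    Set (EuclideanSpace ℝ (Fin d)) :=
  (fun x => x₀ + x) '' parallelepiped v

/-- The region `{(x, y) : x ∈ D, g₁ x ≤ y ≤ g₂ x}` between two graphs over `D`. -/
def graphRegion {d : ℕ} (D : Set (EuclideanSpace ℝ (Fin d)))
    (g₁ g₂ : EuclideanSpace ℝ (Fin d) → ℝ) : Set (EuclideanSpace ℝ (Fin (d + 1))) :=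
  {z | base z ∈ D ∧ g₁ (base z) ≤ height z ∧ height z ≤ g₂ (base z)}

/-- Directions (as unit vectors) of the edges of the parallelepiped `{(x, H x) : x ∈ D}`, the part
of the graph of the affine function `H` over a parallelepiped `D` with edge vectors `vᵢ`: an edge of
`D` parallel to `vᵢ` is lifted to a segment parallel to `(vᵢ, H(x + vᵢ) - H(x))`. Together with
`e_{d+1}` these are the edge directions of `{(x, y) : x ∈ D, H x - δ ≤ y ≤ H x + δ}`; each direction
is represented by one of its two unit vectors. For constant `H` they are the edge directions of
`D`. -/
def edgeDirections {d : ℕ} (v : Fin d → EuclideanSpace ℝ (Fin d))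
    (H : EuclideanSpace ℝ (Fin d) →ᵃ[ℝ] ℝ) : Set (EuclideanSpace ℝ (Fin (d + 1))) :=
  range fun i => ‖pt (v i) (H.linear (v i))‖⁻¹ • pt (v i) (H.linear (v i))

section Moduli

variable {n : ℕ}

open Classical in
/-- The `L^p(Ω)` (quasi-)norm with respect to Lebesgue measure for `0 < p < ∞`, and the uniform norm
on `Ω` for `p = ∞`. -/
def normOn (p : ℝ≥0∞) (f : EuclideanSpace ℝ (Fin n) → ℝ) (Ω : Set (EuclideanSpace ℝ (Fin n))) :
    ℝ≥0∞ :=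
  if p = ∞ then ⨆ x ∈ Ω, ‖f x‖ₑ else eLpNorm f p (volume.restrict Ω)

open Classical in
/-- `f ∈ L^p(Ω)`, with the convention `L^∞(Ω) = C(Ω)`. -/
def MemLpOn (p : ℝ≥0∞) (f : EuclideanSpace ℝ (Fin n) → ℝ) (Ω : Set (EuclideanSpace ℝ (Fin n))) :
    Prop :=
  if p = ∞ then ContinuousOn f Ω else MemLp f p (volume.restrict Ω)

open Classical in
/-- The finite difference `Δ_ξ^r(f, Ω, η)`: it is `∑_j (-1)^(r+j) (r choose j) f(η + jξ)` if the
segment `[η, η + rξ]` lies in `Ω`, and `0` otherwise. -/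
def finDiff (r : ℕ) (ξ : EuclideanSpace ℝ (Fin n)) (f : EuclideanSpace ℝ (Fin n) → ℝ)
    (Ω : Set (EuclideanSpace ℝ (Fin n))) (η : EuclideanSpace ℝ (Fin n)) : ℝ :=
  if segment ℝ η (η + (r : ℝ) • ξ) ⊆ Ω then
    ∑ j ∈ Finset.range (r + 1), (-1 : ℝ) ^ (r + j) * (r.choose j : ℝ) * f (η + (j : ℝ) • ξ)
  else 0

/-- The directional modulus of smoothness `ω^r(f, Ω; 𝓔)_p` of a bounded set `Ω`: the supremum of
`‖Δ_{uξ}^r(f, Ω, ·)‖_{L^p(Ω)}` over `ξ ∈ 𝓔` and `0 < u ≤ diam Ω`. -/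
def modulus (r : ℕ) (p : ℝ≥0∞) (f : EuclideanSpace ℝ (Fin n) → ℝ)
    (Ω 𝓔 : Set (EuclideanSpace ℝ (Fin n))) : ℝ≥0∞ :=
  ⨆ ξ ∈ 𝓔, ⨆ u ∈ Ioc 0 (Metric.diam Ω), normOn p (finDiff r (u • ξ) f Ω) Ω

/-- The space `Π_{r-1}(𝓔)` of the polynomials `Q` such that for every point `x` and every `e ∈ 𝓔`
the function `t ↦ Q(x + te)` is a polynomial of degree `< r`. -/
def dirPoly (r : ℕ) (𝓔 : Set (EuclideanSpace ℝ (Fin n))) : Set (MvPolynomial (Fin n) ℝ) :=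
  {Q | ∀ x : EuclideanSpace ℝ (Fin n), ∀ e ∈ 𝓔, ∃ P : Polynomial ℝ, P.degree < (r : WithBot ℕ) ∧
    ∀ t : ℝ, MvPolynomial.eval (x + t • e).ofLp Q = P.eval t}

/-- The error `E_{r-1}(f; 𝓔)_{L^p(Ω)}` of best approximation from `Π_{r-1}(𝓔)`. -/
def bestApprox (r : ℕ) (p : ℝ≥0∞) (f : EuclideanSpace ℝ (Fin n) → ℝ)
    (Ω 𝓔 : Set (EuclideanSpace ℝ (Fin n))) : ℝ≥0∞ :=
  ⨅ Q ∈ dirPoly r 𝓔, normOn p (fun x => f x - MvPolynomial.eval x.ofLp Q) Ω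

end Moduli

end GraphWhitney

end

/-! In affine coordinates along its edges the slab S is a unit cube K. The proof joins Whitney's
inequality on K for differences along the edges (`exists_normOn_unit_box_sub_le`) to an extension of
the bound from K to G along vertical lines (`normOn_le_slab`). Estimates are stated for an arbitrary
basis, so constants do not depend on the shape of the parallelepiped.

Whitney's inequality. A mixed difference with at least r steps in one edge direction is controlled
by the moduli, because `prod_sub_one_eq_sum` writes r differences with unequal steps through
translates of r-th differences with equal steps. The remaining mixed differences have their multiset
of directions in the finite lower set `exponents`, and these are removed from the top. For a maximal
β, mixed differences along β have small first differences, hence are close to constants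
(`exists_const_normOn_sub_le`, an averaging argument valid for all p > 0). These constants are
bounded and approximately additive in each step, so by a Hyers–Ulam argument
(`abs_sub_multilinear_le`) they are nearly proportional to the product of the steps. A multiple of
the monomial with exponent β has exactly such differences, and subtracting it deletes β from the
lower set. When nothing is left, the empty difference, that is the function itself, is small on a
small cube; `normOn_unit_box_le` spreads this to K one coordinate at a time.

Extension. An r-th difference expresses the value at one end of its segment through the difference
and the r other values. If r steps do not exceed the thickness of a slab, a bound on the slab thus
propagates to a further layer one step thick. Since G reaches at most L times as far from the graph
of H as S does, a number of layers depending only on r and L suffices. Of G this uses only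
measurability and that its vertical fibres are intervals containing those of S; the polynomial is
annihilated by the differences. -/

namespace GraphWhitney

/-! ### The quasi-norm: triangle inequality, translations, unions, constants -/

section NormOn

variable {n : ℕ} {p : ℝ≥0∞} {f g : EuclideanSpace ℝ (Fin n) → ℝ}
  {A B : Set (EuclideanSpace ℝ (Fin n))}

/-- Functions to which the quasi-triangle inequality for `normOn p` applies. -/
def Adm (p : ℝ≥0∞) (f : EuclideanSpace ℝ (Fin n) → ℝ) : Prop := p = ∞ ∨ Measurable f

theorem Adm.add (hf : Adm p f) (hg : Adm p g) : Adm p (fun x => f x + g x) := by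
  rcases hf with h | hf
  · exact Or.inl h
  · rcases hg with h | hg
    · exact Or.inl h
    · exact Or.inr (hf.add hg)

theorem Adm.const_mul (hf : Adm p f) (c : ℝ) : Adm p (fun x => c * f x) :=
  hf.imp id fun h => h.const_mul c

theorem adm_const (c : ℝ) : Adm p (fun _ : EuclideanSpace ℝ (Fin n) => c) :=
  Or.inr measurable_const

theorem Adm.sub (hf : Adm p f) (hg : Adm p g) : Adm p (fun x => f x - g x) := by
  simpa [sub_eq_add_neg] using hf.add (hg.const_mul (-1))

theorem Adm.comp_add (hf : Adm p f) (v : EuclideanSpace ℝ (Fin n)) :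
    Adm p (fun x => f (x + v)) :=
  hf.imp id fun h => h.comp (measurable_add_const v)

theorem adm_sum {ι : Type*} (s : Finset ι) {F : ι → EuclideanSpace ℝ (Fin n) → ℝ}
    (hF : ∀ i ∈ s, Adm p (F i)) : Adm p (fun x => ∑ i ∈ s, F i x) := by
  classical
  induction s using Finset.induction_on with
  | empty => simpa using adm_const 0
  | insert i s hi ih =>
    simp only [Finset.sum_insert hi]
    exact (hF i (by simp)).add (ih fun j hj => hF j (by simp [hj]))

theorem normOn_top : normOn ∞ f A = ⨆ x ∈ A, ‖f x‖ₑ := if_pos rfl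

theorem normOn_of_ne_top (hp : p ≠ ∞) : normOn p f A = eLpNorm f p (volume.restrict A) :=
  if_neg hp

theorem normOn_mono_set (h : A ⊆ B) : normOn p f A ≤ normOn p f B := by
  by_cases hp : p = ∞
  · subst hp
    simp only [normOn_top]
    exact biSup_mono h
  · simp only [normOn_of_ne_top hp]
    exact eLpNorm_mono_measure _ (Measure.restrict_mono h le_rfl)

theorem normOn_le_of_enorm_le (hA : NullMeasurableSet A) (h : ∀ x ∈ A, ‖f x‖ₑ ≤ ‖g x‖ₑ) :
    normOn p f A ≤ normOn p g A := by
  by_cases hp : p = ∞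
  · subst hp
    simp only [normOn_top]
    exact iSup₂_mono h
  · simp only [normOn_of_ne_top hp]
    exact eLpNorm_mono_enorm_ae ((ae_restrict_iff'₀ hA).2 (Filter.Eventually.of_forall h))

theorem normOn_congr (hA : NullMeasurableSet A) (h : ∀ x ∈ A, f x = g x) :
    normOn p f A = normOn p g A :=
  le_antisymm (normOn_le_of_enorm_le hA fun x hx => by rw [h x hx])
    (normOn_le_of_enorm_le hA fun x hx => by rw [h x hx])

/-- The constant of the quasi-triangle inequality. -/
noncomputable def triConst (p : ℝ≥0∞) : ℝ≥0 := (ENNReal.LpAddConst p).toNNReal + 1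

theorem one_le_triConst : 1 ≤ triConst p := by simp [triConst]

theorem lpAddConst_le_triConst : ENNReal.LpAddConst p ≤ triConst p := by
  rw [triConst, ENNReal.coe_add, ENNReal.coe_toNNReal (ENNReal.LpAddConst_lt_top p).ne]
  exact le_self_add

theorem le_triConst_mul (a : ℝ≥0∞) : a ≤ triConst p * a := by
  have h : (1 : ℝ≥0∞) ≤ triConst p := by exact_mod_cast one_le_triConst (p := p)
  exact le_mul_of_one_le_left' h

theorem normOn_add_le (hf : Adm p f) (hg : Adm p g) :
    normOn p (fun x => f x + g x) A ≤ triConst p * (normOn p f A + normOn p g A) := by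
  by_cases hp : p = ∞
  · subst hp
    refine le_trans ?_ (le_triConst_mul _)
    simp only [normOn_top]
    refine iSup₂_le fun x hx => (enorm_add_le _ _).trans (add_le_add ?_ ?_)
    · exact le_iSup₂ (f := fun x (_ : x ∈ A) => ‖f x‖ₑ) x hx
    · exact le_iSup₂ (f := fun x (_ : x ∈ A) => ‖g x‖ₑ) x hx
  · simp only [normOn_of_ne_top hp]
    have hf' := hf.resolve_left hp
    have hg' := hg.resolve_left hp
    refine (eLpNorm_add_le' hf'.aestronglyMeasurable hg'.aestronglyMeasurable p).trans ?_
    gcongr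
    exact lpAddConst_le_triConst

theorem normOn_const_mul (c : ℝ) : normOn p (fun x => c * f x) A = ‖c‖ₑ * normOn p f A := by
  by_cases hp : p = ∞
  · subst hp
    simp only [normOn_top, enorm_mul, ENNReal.mul_iSup]
  · simp only [normOn_of_ne_top hp]
    exact eLpNorm_const_smul c f p _

theorem normOn_neg : normOn p (fun x => -f x) A = normOn p f A := by
  have := normOn_const_mul (p := p) (f := f) (A := A) (-1)
  simpa using this

theorem normOn_zero : normOn p (fun _ : EuclideanSpace ℝ (Fin n) => 0) A = 0 := by
  have := normOn_const_mul (p := p) (f := fun _ => 0) (A := A) 0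
  simpa using this

theorem normOn_sub_le (hf : Adm p f) (hg : Adm p g) :
    normOn p (fun x => f x - g x) A ≤ triConst p * (normOn p f A + normOn p g A) := by
  have := normOn_add_le (A := A) hf (hg.const_mul (-1))
  rw [normOn_const_mul] at this
  simpa [sub_eq_add_neg] using this

theorem normOn_sum_le {ι : Type*} (s : Finset ι) {F : ι → EuclideanSpace ℝ (Fin n) → ℝ}
    (hF : ∀ i ∈ s, Adm p (F i)) :
    normOn p (fun x => ∑ i ∈ s, F i x) A ≤ (triConst p : ℝ≥0∞) ^ s.card * ∑ i ∈ s, normOn p (F i) A := by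
  classical
  induction s using Finset.induction_on with
  | empty => simp [normOn_zero]
  | insert i s hi ih =>
    simp only [Finset.sum_insert hi, Finset.card_insert_of_notMem hi]
    have hs : ∀ j ∈ s, Adm p (F j) := fun j hj => hF j (by simp [hj])
    refine (normOn_add_le (hF i (by simp)) (adm_sum s hs)).trans ?_
    rw [pow_succ', mul_assoc]
    gcongr
    rw [mul_add]
    refine add_le_add ?_ (ih hs)
    have h : (1 : ℝ≥0∞) ≤ (triConst p : ℝ≥0∞) ^ s.card :=
      one_le_pow₀ (by exact_mod_cast one_le_triConst)
    exact le_mul_of_one_le_left' h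

theorem normOn_comp_add_le (v : EuclideanSpace ℝ (Fin n)) (h : ∀ x ∈ A, x + v ∈ B) :
    normOn p (fun x => f (x + v)) A ≤ normOn p f B := by
  by_cases hp : p = ∞
  · subst hp
    simp only [normOn_top]
    exact iSup₂_le fun x hx => le_iSup₂ (f := fun x (_ : x ∈ B) => ‖f x‖ₑ) (x + v) (h x hx)
  · refine (normOn_mono_set (B := (fun x => x + v) ⁻¹' B) h).trans ?_
    simp only [normOn_of_ne_top hp]
    have hmp : MeasurePreserving (fun x : EuclideanSpace ℝ (Fin n) => x + v) volume volume :=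
      measurePreserving_add_right volume v
    have hme : MeasurableEmbedding (fun x : EuclideanSpace ℝ (Fin n) => x + v) :=
      (Homeomorph.addRight v).measurableEmbedding
    have := (hmp.restrict_preimage_emb hme B).map_eq
    rw [← this, hme.eLpNorm_map_measure]
    rfl

/-- Used to add up layers of a region. For 0 < p < ∞ the constant 2^(1/p) comes from a + b ≤ 2
max(a, b), which treats p < 1 and p ≥ 1 alike and needs no measurability. -/
theorem normOn_union_le : ∃ C : ℝ≥0, ∀ (f : EuclideanSpace ℝ (Fin n) → ℝ) (A B : Set _),
    normOn p f (A ∪ B) ≤ C * (normOn p f A + normOn p f B) := by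
  by_cases hp : p = ∞
  · subst hp
    refine ⟨1, fun f A B => ?_⟩
    simp only [normOn_top, ENNReal.coe_one, one_mul]
    refine iSup₂_le fun x hx => ?_
    rcases hx with hx | hx
    · exact (le_iSup₂ (f := fun x (_ : x ∈ A) => ‖f x‖ₑ) x hx).trans le_self_add
    · exact (le_iSup₂ (f := fun x (_ : x ∈ B) => ‖f x‖ₑ) x hx).trans le_add_self
  · by_cases hp0 : p = 0
    · subst hp0
      exact ⟨1, fun f A B => by simp [normOn_of_ne_top]⟩
    have hq : 0 < p.toReal := ENNReal.toReal_pos hp0 hp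
    refine ⟨(2 : ℝ≥0) ^ (1 / p.toReal), fun f A B => ?_⟩
    simp only [normOn_of_ne_top hp, eLpNorm_eq_lintegral_rpow_enorm_toReal hp0 hp]
    set a := ∫⁻ x in A, ‖f x‖ₑ ^ p.toReal
    set b := ∫⁻ x in B, ‖f x‖ₑ ^ p.toReal
    have hq' : 0 ≤ 1 / p.toReal := by positivity
    rw [ENNReal.coe_rpow_of_nonneg _ hq', ← max_add_min (a ^ _)]
    calc (∫⁻ x in A ∪ B, ‖f x‖ₑ ^ p.toReal) ^ (1 / p.toReal)
        ≤ (a + b) ^ (1 / p.toReal) :=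
          ENNReal.rpow_le_rpow (lintegral_union_le _ _ _) hq'
      _ ≤ (2 * max a b) ^ (1 / p.toReal) := by
          refine ENNReal.rpow_le_rpow ?_ hq'
          rw [two_mul]
          exact add_le_add (le_max_left _ _) (le_max_right _ _)
      _ = 2 ^ (1 / p.toReal) * max (a ^ (1 / p.toReal)) (b ^ (1 / p.toReal)) := by
          rw [ENNReal.mul_rpow_of_nonneg _ _ hq',
            (ENNReal.monotone_rpow_of_nonneg hq').map_max]
      _ ≤ _ := by
          simp only [ENNReal.coe_ofNat]
          gcongr
          exact le_self_add

theorem normOn_const (a : ℝ) :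
    normOn p (fun _ => a) A = ‖a‖ₑ * normOn p (fun _ => 1) A := by
  simpa using normOn_const_mul (p := p) (f := fun _ => 1) (A := A) a

theorem normOn_one_ne_zero (hp : 0 < p) (hA : volume A ≠ 0) :
    normOn p (fun _ : EuclideanSpace ℝ (Fin n) => (1 : ℝ)) A ≠ 0 := by
  by_cases hpt : p = ∞
  · subst hpt
    have : A.Nonempty := nonempty_of_measure_ne_zero hA
    obtain ⟨x, hx⟩ := this
    rw [normOn_top]
    refine (lt_of_lt_of_le ?_ (le_iSup₂ (f := fun x (_ : x ∈ A) => ‖(1 : ℝ)‖ₑ) x hx)).ne'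
    simp
  · rw [normOn_of_ne_top hpt, eLpNorm_const _ hp.ne' (by simpa using hA)]
    simp [ENNReal.rpow_eq_zero_iff, hA, ENNReal.toReal_nonneg]

theorem normOn_one_ne_top (hA : volume A ≠ ∞) :
    normOn p (fun _ : EuclideanSpace ℝ (Fin n) => (1 : ℝ)) A ≠ ∞ := by
  by_cases hpt : p = ∞
  · subst hpt
    rw [normOn_top]
    refine ne_top_of_le_ne_top ENNReal.one_ne_top (iSup₂_le fun x hx => by simp)
  · rw [normOn_of_ne_top hpt]
    by_cases hp : p = 0
    · simp [hp]
    rw [eLpNorm_const' _ hp hpt]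
    simp only [enorm_one, one_mul, Measure.restrict_apply_univ]
    exact ENNReal.rpow_ne_top_of_nonneg (by positivity) hA

theorem normOn_ne_top_of_bounded (hA : NullMeasurableSet A) (hA' : volume A ≠ ∞) (M : ℝ)
    (hM : ∀ x ∈ A, |f x| ≤ M) : normOn p f A ≠ ∞ := by
  refine ne_top_of_le_ne_top ?_ (normOn_le_of_enorm_le (g := fun _ => M) hA fun x hx => ?_)
  · rw [normOn_const]
    exact ENNReal.mul_ne_top (by simp) (normOn_one_ne_top hA')
  · rw [Real.enorm_eq_ofReal_abs, Real.enorm_eq_ofReal_abs]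
    exact ENNReal.ofReal_le_ofReal ((hM x hx).trans (le_abs_self M))

end NormOn

/-! ### Parallelepipeds in coordinates, and functions with small first differences -/

section Boxes

variable {n : ℕ} {p : ℝ≥0∞}

/-- The `i`-th coordinate of `z` with respect to the origin `z₀` and the basis `b`. -/
noncomputable def coordAt (b : Module.Basis (Fin n) ℝ (EuclideanSpace ℝ (Fin n)))
    (z₀ : EuclideanSpace ℝ (Fin n)) (i : Fin n) (z : EuclideanSpace ℝ (Fin n)) : ℝ :=
  b.repr (z - z₀) i

/-- The parallelepiped `{z : lo i ≤ τ i ≤ hi i}`, `τ` being the coordinates of `z` with respect to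
the origin `z₀` and the basis `b`. -/
def box (b : Module.Basis (Fin n) ℝ (EuclideanSpace ℝ (Fin n)))
    (z₀ : EuclideanSpace ℝ (Fin n)) (lo hi : Fin n → ℝ) : Set (EuclideanSpace ℝ (Fin n)) :=
  {z | ∀ i, lo i ≤ coordAt b z₀ i z ∧ coordAt b z₀ i z ≤ hi i}

variable (b : Module.Basis (Fin n) ℝ (EuclideanSpace ℝ (Fin n))) (z₀ : EuclideanSpace ℝ (Fin n))
  (lo hi : Fin n → ℝ)

theorem coordAt_add (i : Fin n) (z v : EuclideanSpace ℝ (Fin n)) :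
    coordAt b z₀ i (z + v) = coordAt b z₀ i z + b.repr v i := by
  simp only [coordAt, map_sub, map_add, Finsupp.sub_apply, Finsupp.add_apply]
  ring

theorem coordAt_add_smul (i j : Fin n) (z : EuclideanSpace ℝ (Fin n)) (h : ℝ) :
    coordAt b z₀ i (z + h • b j) = coordAt b z₀ i z + if j = i then h else 0 := by
  rw [coordAt_add]
  simp [Finsupp.single_apply]

theorem continuous_coordAt (i : Fin n) : Continuous (coordAt b z₀ i) := by
  have h : Continuous (b.coord i) := LinearMap.continuous_of_finiteDimensional _
  exact h.comp (continuous_id.sub continuous_const)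

theorem isClosed_box : IsClosed (box b z₀ lo hi) := by
  simp only [box, ofPred_forall, ofPred_and]
  exact isClosed_iInter fun i =>
    (isClosed_le continuous_const (continuous_coordAt b z₀ i)).inter
      (isClosed_le (continuous_coordAt b z₀ i) continuous_const)

theorem measurableSet_box : MeasurableSet (box b z₀ lo hi) := (isClosed_box b z₀ lo hi).measurableSet

theorem eq_add_sum_coordAt (z : EuclideanSpace ℝ (Fin n)) :
    z = z₀ + ∑ i, coordAt b z₀ i z • b i := by
  simp only [coordAt]
  rw [b.sum_repr]
  abel

theorem coordAt_add_sum (t : Fin n → ℝ) (i : Fin n) :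
    coordAt b z₀ i (z₀ + ∑ j, t j • b j) = t i := by
  simp only [coordAt, add_sub_cancel_left]
  rw [b.repr_sum_self]

theorem isCompact_box : IsCompact (box b z₀ lo hi) := by
  have hc : IsCompact ((fun t : Fin n → ℝ => z₀ + ∑ j, t j • b j) '' Icc lo hi) :=
    isCompact_Icc.image (by fun_prop)
  refine hc.of_isClosed_subset (isClosed_box b z₀ lo hi) fun z hz => ?_
  exact ⟨fun i => coordAt b z₀ i z, ⟨fun i => (hz i).1, fun i => (hz i).2⟩,
    (eq_add_sum_coordAt b z₀ z).symm⟩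

theorem volume_box_ne_top : volume (box b z₀ lo hi) ≠ ∞ := (isCompact_box b z₀ lo hi).measure_ne_top

theorem volume_box_ne_zero (h : ∀ i, lo i < hi i) : volume (box b z₀ lo hi) ≠ 0 := by
  have ho : IsOpen {z | ∀ i, lo i < coordAt b z₀ i z ∧ coordAt b z₀ i z < hi i} := by
    simp only [ofPred_forall, ofPred_and]
    exact isOpen_iInter_of_finite fun i =>
      (isOpen_lt continuous_const (continuous_coordAt b z₀ i)).inter
        (isOpen_lt (continuous_coordAt b z₀ i) continuous_const)
  have hne : {z | ∀ i, lo i < coordAt b z₀ i z ∧ coordAt b z₀ i z < hi i}.Nonempty := by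
    refine ⟨z₀ + ∑ j, ((lo j + hi j) / 2) • b j, fun i => ?_⟩
    rw [coordAt_add_sum b z₀ (fun j => (lo j + hi j) / 2)]
    constructor <;> linarith [h i]
  have hsub : {z | ∀ i, lo i < coordAt b z₀ i z ∧ coordAt b z₀ i z < hi i} ⊆ box b z₀ lo hi :=
    fun z hz i => ⟨(hz i).1.le, (hz i).2.le⟩
  exact ((ho.measure_pos volume hne).trans_le (measure_mono hsub)).ne'

theorem box_mono {lo hi lo' hi' : Fin n → ℝ} (h : ∀ i, lo' i ≤ lo i) (h' : ∀ i, hi i ≤ hi' i) :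
    box b z₀ lo hi ⊆ box b z₀ lo' hi' :=
  fun _ hz i => ⟨(h i).trans (hz i).1, (hz i).2.trans (h' i)⟩

theorem add_smul_mem_box {lo hi lo' hi' : Fin n → ℝ} {z : EuclideanSpace ℝ (Fin n)} {i : Fin n}
    {h : ℝ} (hz : z ∈ box b z₀ lo hi) (hlo : ∀ j, lo' j ≤ lo j) (hhi : ∀ j, hi j ≤ hi' j)
    (hlo' : lo' i ≤ lo i + h) (hhi' : hi i + h ≤ hi' i) : z + h • b i ∈ box b z₀ lo' hi' := by
  intro j
  rw [coordAt_add_smul]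
  have := hz j
  split_ifs with hij
  · subst hij
    constructor <;> linarith
  · constructor <;> linarith [hlo j, hhi j]

/-- The parallelepiped of all differences of two points of a cube of side `η` has `2 ^ n` times its
volume. -/
theorem volume_difference_box (lo η : ℝ) :
    volume {v | ∀ i, |b.repr v i| ≤ η} =
      2 ^ n * volume (box b z₀ (fun _ => lo) (fun _ => lo + η)) := by
  set u : EuclideanSpace ℝ (Fin n) := z₀ + ∑ j : Fin n, (lo + η / 2) • b j with hu
  have hset : {v | ∀ i, |b.repr v i| ≤ η} = (fun v => (1 / 2 : ℝ) • v) ⁻¹'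
      ((fun v => v + u) ⁻¹' box b z₀ (fun _ => lo) (fun _ => lo + η)) := by
    ext v
    simp only [mem_ofPred_eq, mem_preimage, box]
    refine forall_congr' fun i => ?_
    have : coordAt b z₀ i ((1 / 2 : ℝ) • v + u) = lo + η / 2 + 1 / 2 * b.repr v i := by
      rw [add_comm, coordAt_add, hu, coordAt_add_sum b z₀ (fun _ => lo + η / 2)]
      simp
    rw [this, abs_le]
    constructor <;> rintro ⟨h1, h2⟩ <;> constructor <;> linarith
  rw [hset, Measure.addHaar_preimage_smul _ (by norm_num), measure_preimage_add_right]
  congr 1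
  simp [abs_of_pos]

/-- A function whose differences along the edges of a cube are small is nearly invariant under all
translations within the cube. -/
theorem normOn_translate_sub_le (s : Finset (Fin n)) : ∃ C : ℝ≥0,
    ∀ (b : Module.Basis (Fin n) ℝ (EuclideanSpace ℝ (Fin n))) (z₀ : EuclideanSpace ℝ (Fin n))
      (lo η : ℝ) (F : EuclideanSpace ℝ (Fin n) → ℝ) (ε : ℝ≥0∞), Adm p F →
      (∀ i, ∀ h ∈ Ioc 0 η, normOn p (fun x => F (x + h • b i) - F x)
        (box b z₀ (fun _ => lo) (fun _ => lo + η)) ≤ ε) →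
      ∀ v, (∀ i ∉ s, b.repr v i = 0) →
        normOn p (fun x => F (x + v) - F x)
          {x | x ∈ box b z₀ (fun _ => lo) (fun _ => lo + η) ∧
            x + v ∈ box b z₀ (fun _ => lo) (fun _ => lo + η)} ≤ C * ε := by
  classical
  induction s using Finset.induction_on with
  | empty =>
    refine ⟨1, fun b z₀ lo η F ε hF h v hv => ?_⟩
    have : v = 0 := b.repr.map_eq_zero_iff.1 (Finsupp.ext fun i => hv i (by simp))
    subst this
    simp [normOn_zero]
  | insert i s hi ih =>
    obtain ⟨C, hC⟩ := ih
    refine ⟨triConst p * (1 + C), fun b z₀ lo η F ε hF h v hv => ?_⟩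
    set Q := box b z₀ (fun _ => lo) (fun _ => lo + η) with hQ
    set A := {x | x ∈ Q ∧ x + v ∈ Q} with hA
    set t := b.repr v i with ht
    -- The way from x to x + v passes through x + v', which has the i-th coordinate of x and the
    -- other coordinates of x + v, and therefore stays in the cube.
    set v' := v - t • b i with hv'
    have hvv : v = v' + t • b i := by simp [hv']
    have hrepr : ∀ j, b.repr v' j = if i = j then 0 else b.repr v j := by
      intro j
      simp only [hv', map_sub, map_smul, Finsupp.sub_apply, Finsupp.smul_apply, b.repr_self,
        Finsupp.single_apply]
      split_ifs with hij
      · subst hij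
        simp [ht]
      · simp
    have hmem : ∀ x ∈ A, x + v' ∈ Q := by
      rintro x ⟨hx1, hx2⟩ j
      have h1 := hx1 j
      have h2 := hx2 j
      rw [coordAt_add] at h2 ⊢
      rw [hrepr]
      split_ifs with hij
      · simpa using h1
      · exact h2
    have h1 : normOn p (fun x => F (x + v) - F (x + v')) A ≤ ε := by
      rcases A.eq_empty_or_nonempty with hA0 | ⟨x, hx⟩
      · have : normOn p (fun x => F (x + v) - F (x + v')) A ≤ normOn p (fun _ => 0) A :=
          normOn_le_of_enorm_le (by simp [hA0]) (by simp [hA0])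
        rw [normOn_zero] at this
        exact this.trans zero_le
      have htη : |t| ≤ η := by
        have h1 := hx.1 i
        have h2 := hx.2 i
        rw [coordAt_add] at h2
        rw [abs_le]
        constructor <;> linarith
      rcases lt_trichotomy t 0 with ht0 | ht0 | ht0
      -- A backward step from x + v' to x + v is a forward step seen from x + v.
      · have h3 := h i (-t) ⟨by linarith, by rwa [abs_of_neg ht0] at htη⟩
        refine le_trans ?_ h3
        rw [← normOn_neg]
        have h4 := normOn_comp_add_le (p := p) (f := fun x => F (x + (-t) • b i) - F x) (A := A)
          (B := Q) v (fun x hx => hx.2)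
        refine le_trans (le_of_eq ?_) h4
        congr 1
        funext x
        have : x + v + -t • b i = x + v' := by rw [hv']; module
        rw [this]
        ring
      · have : v' = v := by simp [hv', ht0]
        simp [this, normOn_zero]
      · have h3 := h i t ⟨ht0, by rwa [abs_of_pos ht0] at htη⟩
        refine le_trans ?_ h3
        have h4 := normOn_comp_add_le (p := p) (f := fun x => F (x + t • b i) - F x) (A := A)
          (B := Q) v' hmem
        refine le_trans (le_of_eq ?_) h4
        congr 1
        funext x
        have : x + v' + t • b i = x + v := by rw [hv']; module
        rw [this]
    have h2 : normOn p (fun x => F (x + v') - F x) A ≤ C * ε := by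
      refine (normOn_mono_set fun x hx => ?_).trans (hC b z₀ lo η F ε hF h v' fun j hj => ?_)
      · exact ⟨hx.1, hmem x hx⟩
      · rw [hrepr]
        split_ifs with hij
        · rfl
        · exact hv j (by simp [hj, Ne.symm hij])
    have h3 := normOn_add_le (p := p) (A := A) ((hF.comp_add v).sub (hF.comp_add v'))
      ((hF.comp_add v').sub hF)
    simp only [sub_add_sub_cancel] at h3
    refine h3.trans ?_
    rw [ENNReal.coe_mul, mul_assoc]
    gcongr
    rw [ENNReal.coe_add, add_mul, ENNReal.coe_one, one_mul]
    exact add_le_add h1 h2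

/-- A function whose differences along the edges of a cube are small is nearly constant. -/
theorem exists_const_normOn_sub_le (hp : 0 < p) : ∃ C : ℝ≥0,
    ∀ (b : Module.Basis (Fin n) ℝ (EuclideanSpace ℝ (Fin n))) (z₀ : EuclideanSpace ℝ (Fin n))
      (lo η : ℝ) (F : EuclideanSpace ℝ (Fin n) → ℝ) (ε : ℝ≥0∞), 0 < η → Adm p F →
      (∀ i, ∀ h ∈ Ioc 0 η, normOn p (fun x => F (x + h • b i) - F x)
        (box b z₀ (fun _ => lo) (fun _ => lo + η)) ≤ ε) →
      ∃ a : ℝ, normOn p (fun x => F x - a) (box b z₀ (fun _ => lo) (fun _ => lo + η)) ≤ C * ε := by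
  obtain ⟨C, hC⟩ := normOn_translate_sub_le (p := p) (Finset.univ : Finset (Fin n))
  by_cases hpt : p = ∞
  · subst hpt
    refine ⟨C, fun b z₀ lo η F ε hη hF h => ?_⟩
    have hne := nonempty_of_measure_ne_zero
      (volume_box_ne_zero b z₀ (fun _ => lo) (fun _ => lo + η) (fun _ => by linarith))
    obtain ⟨y, hy⟩ := hne
    refine ⟨F y, ?_⟩
    rw [normOn_top]
    refine iSup₂_le fun x hx => ?_
    have := hC b z₀ lo η F ε hF h (x - y) (by simp)
    rw [normOn_top] at this
    refine le_trans ?_ this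
    refine le_trans (le_of_eq ?_) (le_iSup₂ (f := fun z (_ : z ∈
      {x_1 | x_1 ∈ box b z₀ (fun _ => lo) (fun _ => lo + η) ∧
        x_1 + (x - y) ∈ box b z₀ (fun _ => lo) (fun _ => lo + η)}) =>
        ‖F (z + (x - y)) - F z‖ₑ) y ⟨hy, by simpa using hx⟩)
    simp
  · have hq : 0 < p.toReal := ENNReal.toReal_pos hp.ne' hpt
    set q := p.toReal with hqdef
    refine ⟨(2 : ℝ≥0) ^ ((n : ℝ) * (1 / q)) * C, fun b z₀ lo η F ε hη hF h => ?_⟩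
    have hFm := hF.resolve_left hpt
    have hCv := fun v => hC b z₀ lo η F ε hF h v (by simp)
    set Q := box b z₀ (fun _ => lo) (fun _ => lo + η) with hQ
    have hQm : MeasurableSet Q := measurableSet_box _ _ _ _
    have hQ0 : volume Q ≠ 0 := volume_box_ne_zero _ _ _ _ (fun _ => by linarith)
    have hQt : volume Q ≠ ∞ := volume_box_ne_top _ _ _ _
    set V := {v | ∀ i, |b.repr v i| ≤ η} with hV
    -- Φ x v is ‖F (x + v) - F x‖^q when both points lie in the cube and 0 otherwise. Integrating
    -- first over v gives the double integral over Q × Q, integrating first over x gives the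
    -- translation estimates.
    set Φ : EuclideanSpace ℝ (Fin n) → EuclideanSpace ℝ (Fin n) → ℝ≥0∞ := fun x v =>
      Q.indicator (fun _ => Q.indicator (fun y => ‖F y - F x‖ₑ ^ q) (x + v)) x with hΦ
    have hΦm : Measurable (Function.uncurry Φ) := by
      have : Function.uncurry Φ = ({z : _ × _ | z.1 ∈ Q} ∩ {z | z.1 + z.2 ∈ Q}).indicator
          (fun z => ‖F (z.1 + z.2) - F z.1‖ₑ ^ q) := by
        funext ⟨x, v⟩
        by_cases h1 : x ∈ Q <;> by_cases h2 : x + v ∈ Q <;>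
          simp [Function.uncurry, hΦ, h1, h2]
      rw [this]
      refine Measurable.indicator ?_ ((measurable_fst hQm).inter
        ((measurable_fst.add measurable_snd) hQm))
      exact (((hFm.comp (measurable_fst.add measurable_snd)).sub
        (hFm.comp measurable_fst)).enorm).pow_const q
    have hΦv : ∀ v, ∫⁻ x, Φ x v ≤ V.indicator (fun _ => (C * ε) ^ q) v := by
      intro v
      have hΦA : ∀ x, Φ x v = {x | x ∈ Q ∧ x + v ∈ Q}.indicator
          (fun x => ‖F (x + v) - F x‖ₑ ^ q) x := by
        intro x
        by_cases h1 : x ∈ Q <;> by_cases h2 : x + v ∈ Q <;> simp [hΦ, h1, h2]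
      by_cases hv : v ∈ V
      · rw [indicator_of_mem hv]
        have h1 := hCv v
        rw [normOn_of_ne_top hpt, eLpNorm_eq_lintegral_rpow_enorm_toReal hp.ne' hpt] at h1
        simp only [hΦA]
        have hAm : MeasurableSet {x | x ∈ Q ∧ x + v ∈ Q} :=
          hQm.inter ((measurable_add_const v) hQm)
        rw [lintegral_indicator hAm]
        have h2 := ENNReal.rpow_le_rpow h1 hq.le
        rwa [← ENNReal.rpow_mul, one_div, inv_mul_cancel₀ hq.ne', ENNReal.rpow_one] at h2
      · rw [indicator_of_notMem hv]
        have : ∀ x, Φ x v = 0 := by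
          intro x
          rw [hΦA, indicator_of_notMem]
          rintro ⟨h1, h2⟩
          refine hv fun i => ?_
          have h1 := h1 i
          have h2 := h2 i
          rw [coordAt_add] at h2
          rw [abs_le]
          constructor <;> linarith
        simp [this]
    have hint : ∫⁻ x in Q, ∫⁻ y in Q, ‖F y - F x‖ₑ ^ q ≤ (C * ε) ^ q * volume V := by
      calc ∫⁻ x in Q, ∫⁻ y in Q, ‖F y - F x‖ₑ ^ q = ∫⁻ x, ∫⁻ v, Φ x v := by
            rw [← lintegral_indicator hQm]
            refine lintegral_congr fun x => ?_
            by_cases hx : x ∈ Q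
            · simp only [hΦ, indicator_of_mem hx]
              rw [lintegral_add_left_eq_self (fun y => Q.indicator (fun y => ‖F y - F x‖ₑ ^ q) y) x,
                lintegral_indicator hQm]
            · simp [hΦ, hx]
        _ = ∫⁻ v, ∫⁻ x, Φ x v := lintegral_lintegral_swap hΦm.aemeasurable
        _ ≤ ∫⁻ v, V.indicator (fun _ => (C * ε) ^ q) v := lintegral_mono hΦv
        _ ≤ (C * ε) ^ q * volume V := lintegral_indicator_const_le _ _
    have hmeas : AEMeasurable (fun x => ∫⁻ y in Q, ‖F y - F x‖ₑ ^ q) (volume.restrict Q) := by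
      refine Measurable.aemeasurable (Measurable.lintegral_prod_right' (ν := volume.restrict Q)
        (f := fun z : _ × _ => ‖F z.2 - F z.1‖ₑ ^ q) ?_)
      exact (((hFm.comp measurable_snd).sub (hFm.comp measurable_fst)).enorm).pow_const q
    -- The constant is the value of F at a point where the inner integral is at most its average; no
    -- mean of F is formed, so p < 1 is allowed. The ratio of the volumes of V and Q contributes
    -- 2^n.
    obtain ⟨x, hx, hle⟩ := exists_le_setLAverage hQ0 hQt hmeas
    refine ⟨F x, ?_⟩
    rw [setLAverage_eq] at hle
    have hle' : ∫⁻ y in Q, ‖F y - F x‖ₑ ^ q ≤ 2 ^ n * (C * ε) ^ q := by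
      refine hle.trans (ENNReal.div_le_of_le_mul (hint.trans (le_of_eq ?_)))
      rw [hV, volume_difference_box b z₀ lo η]
      ring
    rw [normOn_of_ne_top hpt, eLpNorm_eq_lintegral_rpow_enorm_toReal hp.ne' hpt]
    have hq' : 0 ≤ 1 / q := by positivity
    refine (ENNReal.rpow_le_rpow hle' hq').trans (le_of_eq ?_)
    rw [ENNReal.mul_rpow_of_nonneg _ _ hq', ← ENNReal.rpow_mul, mul_one_div_cancel hq.ne',
      ENNReal.rpow_one, ENNReal.coe_mul, ENNReal.coe_rpow_of_nonneg _ (by positivity),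
      ENNReal.rpow_mul, ENNReal.rpow_natCast, mul_assoc]
    simp

end Boxes

/-! ### Differences as elements of the group algebra of translations -/

section Shifts

variable {n : ℕ} {p : ℝ≥0∞}

/-- The action of the group algebra of `ℝ^n` on functions by translations. -/
noncomputable def shiftAlg (n : ℕ) : AddMonoidAlgebra ℝ (EuclideanSpace ℝ (Fin n)) →ₐ[ℝ]
    Module.End ℝ (EuclideanSpace ℝ (Fin n) → ℝ) :=
  AddMonoidAlgebra.lift ℝ _ (EuclideanSpace ℝ (Fin n))
    { toFun := fun v =>
        { toFun := fun f x => f (x + v.toAdd)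
          map_add' := fun _ _ => rfl
          map_smul' := fun _ _ => rfl }
      map_one' := by
        ext f x
        simp
      map_mul' := fun u v => by
        ext f x
        simp only [toAdd_mul, LinearMap.coe_mk, AddHom.coe_mk, Module.End.mul_apply]
        congr 1
        abel }

/-- Translation by `v` as an element of the group algebra. -/
noncomputable def shift (v : EuclideanSpace ℝ (Fin n)) :
    AddMonoidAlgebra ℝ (EuclideanSpace ℝ (Fin n)) := AddMonoidAlgebra.single v 1

theorem shift_zero : shift (0 : EuclideanSpace ℝ (Fin n)) = 1 := rfl

theorem shift_add (u v : EuclideanSpace ℝ (Fin n)) : shift (u + v) = shift u * shift v := by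
  simp [shift, AddMonoidAlgebra.single_mul_single]

theorem shiftAlg_shift (v : EuclideanSpace ℝ (Fin n)) (f : EuclideanSpace ℝ (Fin n) → ℝ) :
    shiftAlg n (shift v) f = fun x => f (x + v) := by
  rw [shiftAlg, shift, AddMonoidAlgebra.lift_single]
  rw [one_smul]
  rfl

theorem shiftAlg_shift_mul (v : EuclideanSpace ℝ (Fin n))
    (q : AddMonoidAlgebra ℝ (EuclideanSpace ℝ (Fin n))) (f : EuclideanSpace ℝ (Fin n) → ℝ) :
    shiftAlg n (shift v * q) f = fun x => shiftAlg n q f (x + v) := by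
  rw [map_mul, Module.End.mul_apply, shiftAlg_shift]

theorem shiftAlg_pow_sub_one (v : EuclideanSpace ℝ (Fin n)) (r : ℕ)
    (f : EuclideanSpace ℝ (Fin n) → ℝ) (x : EuclideanSpace ℝ (Fin n)) :
    shiftAlg n ((shift v - 1) ^ r) f x =
      ∑ j ∈ Finset.range (r + 1), (-1 : ℝ) ^ (r + j) * (r.choose j : ℝ) * f (x + (j : ℝ) • v) := by
  have hpow : ∀ j : ℕ, shift v ^ j = shift ((j : ℝ) • v) := by
    intro j
    simp [shift, AddMonoidAlgebra.single_pow, Nat.cast_smul_eq_nsmul]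
  have h : (shift v - 1) ^ r = ∑ j ∈ Finset.range (r + 1),
      ((-1 : ℝ) ^ (r + j) * (r.choose j : ℝ)) • shift ((j : ℝ) • v) := by
    rw [sub_eq_add_neg, add_pow]
    refine Finset.sum_congr rfl fun j hj => ?_
    rw [hpow, Algebra.smul_def]
    have hj' : j ≤ r := Nat.lt_succ_iff.1 (Finset.mem_range.1 hj)
    have hs : (-1 : AddMonoidAlgebra ℝ (EuclideanSpace ℝ (Fin n))) ^ (r - j) = (-1) ^ (r + j) := by
      have : r + j = (r - j) + 2 * j := by omega
      rw [this, pow_add, pow_mul]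
      simp
    rw [hs]
    simp only [map_mul, map_pow, map_neg, map_one, map_natCast]
    ring
  rw [h, map_sum]
  simp only [map_smul, LinearMap.sum_apply, LinearMap.smul_apply, Finset.sum_apply, Pi.smul_apply,
    shiftAlg_shift, smul_eq_mul]

/-- The mixed difference operator whose steps are the multiples `a.2` of the basis vectors `b a.1`,
for `a ∈ m`. -/
noncomputable def mixedDiff (b : Module.Basis (Fin n) ℝ (EuclideanSpace ℝ (Fin n)))
    (m : Multiset (Fin n × ℝ)) : AddMonoidAlgebra ℝ (EuclideanSpace ℝ (Fin n)) :=
  (m.map fun a => shift (a.2 • b a.1) - 1).prod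

variable (b : Module.Basis (Fin n) ℝ (EuclideanSpace ℝ (Fin n))) (z₀ : EuclideanSpace ℝ (Fin n))

theorem mixedDiff_zero (f : EuclideanSpace ℝ (Fin n) → ℝ) : shiftAlg n (mixedDiff b 0) f = f := by
  simp [mixedDiff]

theorem mixedDiff_cons (a : Fin n × ℝ) (m : Multiset (Fin n × ℝ)) :
    mixedDiff b (a ::ₘ m) = (shift (a.2 • b a.1) - 1) * mixedDiff b m := by
  simp [mixedDiff]

theorem mixedDiff_add (m m' : Multiset (Fin n × ℝ)) :
    mixedDiff b (m + m') = mixedDiff b m * mixedDiff b m' := by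
  simp [mixedDiff]

theorem shiftAlg_mixedDiff_cons (a : Fin n × ℝ) (m : Multiset (Fin n × ℝ))
    (f : EuclideanSpace ℝ (Fin n) → ℝ) :
    shiftAlg n (mixedDiff b (a ::ₘ m)) f = fun x =>
      shiftAlg n (mixedDiff b m) f (x + a.2 • b a.1) - shiftAlg n (mixedDiff b m) f x := by
  rw [mixedDiff_cons, sub_mul, map_sub, LinearMap.sub_apply, shiftAlg_shift_mul, one_mul]
  rfl

/-- Differences commute, so the added one may act first, directly on f. This form suits inductions
in which f itself changes. -/
theorem shiftAlg_mixedDiff_cons' (a : Fin n × ℝ) (m : Multiset (Fin n × ℝ))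
    (f : EuclideanSpace ℝ (Fin n) → ℝ) :
    shiftAlg n (mixedDiff b (a ::ₘ m)) f =
      shiftAlg n (mixedDiff b m) (fun x => f (x + a.2 • b a.1) - f x) := by
  rw [mixedDiff_cons, mul_comm, map_mul, Module.End.mul_apply, map_sub, LinearMap.sub_apply,
    shiftAlg_shift, map_one]
  rfl

theorem adm_shiftAlg_mixedDiff (m : Multiset (Fin n × ℝ)) {f : EuclideanSpace ℝ (Fin n) → ℝ}
    (hf : Adm p f) : Adm p (shiftAlg n (mixedDiff b m) f) := by
  induction m using Multiset.induction_on with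
  | empty => rwa [mixedDiff_zero]
  | cons a m ih =>
    rw [shiftAlg_mixedDiff_cons]
    exact (ih.comp_add _).sub ih

/-- Each single difference costs a factor `2 * triConst p` and, its step being positive, enlarges
the cube only upwards and by at most η. -/
theorem normOn_mixedDiff_le {η : ℝ} (m : Multiset (Fin n × ℝ))
    (hm : ∀ a ∈ m, a.2 ∈ Ioc 0 η) {f : EuclideanSpace ℝ (Fin n) → ℝ} (hf : Adm p f)
    (lo hi hi' : ℝ) (hhi : hi + Multiset.card m * η ≤ hi') :
    normOn p (shiftAlg n (mixedDiff b m) f) (box b z₀ (fun _ => lo) (fun _ => hi)) ≤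
      (2 * triConst p : ℝ≥0∞) ^ Multiset.card m *
        normOn p f (box b z₀ (fun _ => lo) (fun _ => hi')) := by
  induction m using Multiset.induction_on generalizing hi with
  | empty =>
    simp only [mixedDiff_zero, Multiset.card_zero, pow_zero, one_mul]
    refine normOn_mono_set (box_mono b z₀ (fun _ => le_rfl) fun _ => ?_)
    simpa using hhi
  | cons a m ih =>
    have ha := hm a (by simp)
    have hη : 0 ≤ η := ha.1.le.trans ha.2
    have hF := adm_shiftAlg_mixedDiff (p := p) b m hf
    rw [Multiset.card_cons] at hhi ⊢
    push_cast at hhi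
    have ih' := ih (fun a ha => hm a (by simp [ha])) (hi + η) (by linarith)
    rw [shiftAlg_mixedDiff_cons]
    refine (normOn_sub_le (hF.comp_add _) hF).trans ?_
    have h1 := normOn_comp_add_le (p := p) (f := shiftAlg n (mixedDiff b m) f)
      (A := box b z₀ (fun _ => lo) (fun _ => hi))
      (B := box b z₀ (fun _ => lo) (fun _ => hi + η)) (a.2 • b a.1)
      (fun x hx => add_smul_mem_box b z₀ hx (fun _ => le_rfl) (fun _ => by linarith)
        (by linarith [ha.1]) (by linarith [ha.2]))
    have h2 : normOn p (shiftAlg n (mixedDiff b m) f) (box b z₀ (fun _ => lo) (fun _ => hi)) ≤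
        normOn p (shiftAlg n (mixedDiff b m) f) (box b z₀ (fun _ => lo) (fun _ => hi + η)) :=
      normOn_mono_set (box_mono b z₀ (fun _ => le_rfl) fun _ => by linarith)
    calc _ ≤ (triConst p : ℝ≥0∞) * (_ + _) := mul_le_mul_right (add_le_add h1 h2) _
      _ = 2 * triConst p * normOn p (shiftAlg n (mixedDiff b m) f)
          (box b z₀ (fun _ => lo) (fun _ => hi + η)) := by ring
      _ ≤ 2 * triConst p * _ := mul_le_mul_right ih' _
      _ = _ := by ring

/-- A product of differences with arbitrary steps as a combination of translates of differences with
equal steps. -/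
theorem prod_sub_one_eq_sum {R : Type*} [CommRing R] (e : ℝ → R) (e_zero : e 0 = 1)
    (e_add : ∀ s t, e (s + t) = e s * e t) (r : ℕ) (h : ℕ → ℝ) :
    ∏ j ∈ Finset.range r, (e (h j) - 1) =
      ∑ s ∈ (Finset.range r).powerset, (-1) ^ s.card *
        (e (∑ j ∈ s, h j) * (e (-∑ j ∈ s, h j / (j + 1)) - 1) ^ r) := by
  have e_sum : ∀ (s : Finset ℕ) (g : ℕ → ℝ), e (∑ j ∈ s, g j) = ∏ j ∈ s, e (g j) := by
    intro s g
    induction s using Finset.cons_induction with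
    | empty => simp [e_zero]
    | cons a s ha ih => rw [Finset.sum_cons, Finset.prod_cons, e_add, ih]
  have e_pow : ∀ (k : ℕ) (t : ℝ), e t ^ k = e (k * t) := by
    intro k t
    induction k with
    | zero => simp [e_zero]
    | succ k ih => rw [pow_succ, ih, ← e_add]; push_cast; ring_nf
  -- After binomial expansion of the r-th power, the sum over subsets belonging to a fixed k factors
  -- into a product over j.
  have key : ∀ k : ℕ, ∑ s ∈ (Finset.range r).powerset, (-1) ^ s.card *
      (e (∑ j ∈ s, h j) * e (-∑ j ∈ s, h j / (j + 1)) ^ k) =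
        ∏ j ∈ Finset.range r, (1 - e (h j - k * (h j / (j + 1)))) := by
    intro k
    have : ∀ j, 1 - e (h j - k * (h j / (j + 1))) = -e (h j - k * (h j / (j + 1))) + 1 := by
      intro j; ring
    simp only [this, Finset.prod_add, Finset.prod_const_one, mul_one, Finset.prod_neg]
    refine Finset.sum_congr rfl fun s _ => ?_
    rw [e_pow, ← e_add, ← e_sum]
    congr 2
    rw [mul_neg, Finset.mul_sum, ← sub_eq_add_neg, ← Finset.sum_sub_distrib]
  -- The divisors j + 1 are chosen so that the term k + 1 contains the factor 1 - e 0, at j = k.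
  -- Only the term 0 survives, and it is the required product up to the sign (-1)^r.
  have key0 : ∀ k : ℕ, k ∈ Finset.range r →
      ∏ j ∈ Finset.range r, (1 - e (h j - (k + 1 : ℕ) * (h j / (j + 1)))) = 0 := by
    intro k hk
    refine Finset.prod_eq_zero hk ?_
    have : h k - (k + 1 : ℕ) * (h k / (k + 1)) = 0 := by
      push_cast
      field_simp
      ring
    rw [this, e_zero, sub_self]
  have expand : ∀ x : R, (x - 1) ^ r =
      ∑ k ∈ Finset.range (r + 1), x ^ k * ((-1) ^ (r - k) * (r.choose k : R)) := by
    intro x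
    rw [sub_eq_add_neg, add_pow]
    exact Finset.sum_congr rfl fun k _ => by ring
  simp only [expand]
  have : ∑ s ∈ (Finset.range r).powerset, (-1) ^ s.card * (e (∑ j ∈ s, h j) *
      ∑ k ∈ Finset.range (r + 1), e (-∑ j ∈ s, h j / (j + 1)) ^ k *
        ((-1) ^ (r - k) * (r.choose k : R))) =
      ∑ k ∈ Finset.range (r + 1), (∏ j ∈ Finset.range r, (1 - e (h j - k * (h j / (j + 1))))) *
        ((-1) ^ (r - k) * (r.choose k : R)) := by
    simp only [← key, Finset.mul_sum, Finset.sum_mul]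
    rw [Finset.sum_comm]
    exact Finset.sum_congr rfl fun k _ => Finset.sum_congr rfl fun s _ => by ring
  rw [this, Finset.sum_range_succ', Finset.sum_eq_zero, zero_add]
  · simp only [Nat.cast_zero, zero_mul, sub_zero, Nat.choose_zero_right, Nat.cast_one, mul_one]
    have hsign : (-1 : R) ^ r = ∏ _j ∈ Finset.range r, (-1 : R) := by simp
    rw [Nat.sub_zero, mul_comm, hsign, ← Finset.prod_mul_distrib]
    exact Finset.prod_congr rfl fun j _ => by ring
  · intro k hk
    rw [key0 k hk, zero_mul]

/-- Numbers the steps, as `prod_sub_one_eq_sum` requires, since its divisors j + 1 depend on the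
position. -/
theorem mixedDiff_eq_prod_range (i : Fin n) (m : Multiset (Fin n × ℝ)) (hi : ∀ a ∈ m, a.1 = i)
    {S : Set ℝ} (hS : ∀ a ∈ m, a.2 ∈ S) :
    ∃ h : ℕ → ℝ, (∀ j < Multiset.card m, h j ∈ S) ∧
      mixedDiff b m = ∏ j ∈ Finset.range (Multiset.card m), (shift (h j • b i) - 1) := by
  induction m using Multiset.induction_on with
  | empty => exact ⟨fun _ => 0, by simp, by simp [mixedDiff]⟩
  | cons a m ih =>
    obtain ⟨h, h1, h2⟩ := ih (fun a ha => hi a (by simp [ha])) (fun a ha => hS a (by simp [ha]))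
    refine ⟨fun j => if j = Multiset.card m then a.2 else h j, fun j hj => ?_, ?_⟩
    · rw [Multiset.card_cons] at hj
      dsimp only
      split_ifs with hjm
      · exact hS a (by simp)
      · exact h1 j (by omega)
    · rw [mixedDiff_cons, Multiset.card_cons, Finset.prod_range_succ, mul_comm, h2,
        hi a (by simp)]
      congr 1
      · refine Finset.prod_congr rfl fun j hj => ?_
        dsimp only
        rw [if_neg (Finset.mem_range.1 hj).ne]
      · simp

/-- Mixed differences along one edge are controlled by differences with equal steps. -/
theorem normOn_mixedDiff_single_le (r : ℕ) (hr : 1 ≤ r) : ∃ C : ℝ≥0,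
    ∀ (b : Module.Basis (Fin n) ℝ (EuclideanSpace ℝ (Fin n))) (z₀ : EuclideanSpace ℝ (Fin n))
      (f : EuclideanSpace ℝ (Fin n) → ℝ) (ω : ℝ≥0∞) (i : Fin n), Adm p f →
      (∀ h ∈ Ioc (0 : ℝ) 1, normOn p (shiftAlg n ((shift (h • b i) - 1) ^ r) f)
        {z | z ∈ box b z₀ (fun _ => 0) (fun _ => 1) ∧
          z + (r * h) • b i ∈ box b z₀ (fun _ => 0) (fun _ => 1)} ≤ ω) →
      ∀ (lo hi η : ℝ) (m : Multiset (Fin n × ℝ)), Multiset.card m = r → (∀ a ∈ m, a.1 = i) →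
        (∀ a ∈ m, a.2 ∈ Ioc 0 η) → 0 ≤ η → r ^ 2 * η ≤ lo → hi + r * η ≤ 1 → r * η ≤ 1 →
        normOn p (shiftAlg n (mixedDiff b m) f) (box b z₀ (fun _ => lo) (fun _ => hi)) ≤ C * ω := by
  refine ⟨triConst p ^ 2 ^ r * 2 ^ r, fun b z₀ f ω i hf hω lo hi η m hmr hmi hmη hη hlo hhi hη1 => ?_⟩
  obtain ⟨h, hh, hm⟩ := mixedDiff_eq_prod_range b i m hmi hmη
  rw [hmr] at hh hm
  have hmem : ∀ s ∈ (Finset.range r).powerset, ∀ j ∈ s, h j ∈ Ioc 0 η := fun s hs j hj =>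
    hh j (Finset.mem_range.1 (Finset.mem_powerset.1 hs hj))
  have hadm : ∀ (q : ℕ) (v : EuclideanSpace ℝ (Fin n)), Adm p (shiftAlg n ((shift v - 1) ^ q) f) := by
    intro q v
    induction q with
    | zero => simpa using hf
    | succ q ih =>
      rw [pow_succ', sub_mul, map_sub, one_mul, LinearMap.sub_apply, shiftAlg_shift_mul]
      exact (ih.comp_add v).sub ih
  set σ : Finset ℕ → ℝ := fun s => ∑ j ∈ s, h j / (j + 1) with hσ
  have hid : shiftAlg n (mixedDiff b m) f = fun x => ∑ s ∈ (Finset.range r).powerset,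
      ((-1 : ℝ) ^ s.card * (-1) ^ r) * shiftAlg n ((shift (σ s • b i) - 1) ^ r) f
        (x + ((∑ j ∈ s, h j) - r * σ s) • b i) := by
    rw [hm, prod_sub_one_eq_sum (fun t => shift (t • b i)) (by simp [shift_zero])
      (fun s t => by rw [add_smul, shift_add])]
    have : ∀ s : Finset ℕ, (-1) ^ s.card * (shift ((∑ j ∈ s, h j) • b i) *
        (shift ((-∑ j ∈ s, h j / (j + 1)) • b i) - 1) ^ r) = ((-1 : ℝ) ^ s.card * (-1) ^ r) •
          (shift (((∑ j ∈ s, h j) - r * σ s) • b i) * (shift (σ s • b i) - 1) ^ r) := by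
      intro s
      -- The identity produces backward differences; they are made forward at the price of a sign
      -- and, after taking the r-th power, a translation by -rσ.
      have h1 : shift ((-∑ j ∈ s, h j / (j + 1)) • b i) - 1 =
          -1 * shift ((-σ s) • b i) * (shift (σ s • b i) - 1) := by
        have : shift ((-σ s) • b i) * shift (σ s • b i) = 1 := by
          rw [← shift_add, ← add_smul]; simp [shift_zero]
        linear_combination this
      have h2 : ∀ k : ℕ, shift ((-σ s) • b i) ^ k = shift ((-(k * σ s)) • b i) := by
        intro k
        induction k with
        | zero => simp [shift_zero]
        | succ k ih =>
          rw [pow_succ, ih, ← shift_add, ← add_smul]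
          push_cast
          ring_nf
      rw [h1, mul_pow, mul_pow, h2, sub_eq_add_neg (∑ j ∈ s, h j), add_smul, shift_add,
        Algebra.smul_def]
      simp only [map_mul, map_pow, map_neg, map_one]
      ring
    simp only [this]
    funext x
    simp only [map_sum, map_smul, LinearMap.sum_apply, LinearMap.smul_apply, Finset.sum_apply,
      Pi.smul_apply, shiftAlg_shift_mul, smul_eq_mul]
  rw [hid]
  refine (normOn_sum_le _ fun s _ => ((hadm r _).comp_add _).const_mul _).trans ?_
  rw [Finset.card_powerset, Finset.card_range, ENNReal.coe_mul, mul_assoc, ENNReal.coe_pow]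
  gcongr
  have hone : ∀ s ∈ (Finset.range r).powerset, normOn p (fun x => ((-1 : ℝ) ^ s.card * (-1) ^ r) *
      shiftAlg n ((shift (σ s • b i) - 1) ^ r) f (x + ((∑ j ∈ s, h j) - r * σ s) • b i))
        (box b z₀ (fun _ => lo) (fun _ => hi)) ≤ ω := by
    intro s hs
    rw [normOn_const_mul]
    have : ‖(-1 : ℝ) ^ s.card * (-1) ^ r‖ₑ = 1 := by simp [enorm_mul]
    rw [this, one_mul]
    -- The empty subset has step 0, which `hω` does not cover; its term vanishes because r ≥ 1.
    rcases s.eq_empty_or_nonempty with rfl | hne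
    · simp only [hσ, Finset.sum_empty, zero_smul, shift_zero, sub_self]
      rw [zero_pow (by omega), map_zero]
      simp only [LinearMap.zero_apply, Pi.zero_apply]
      rw [normOn_zero]
      exact zero_le
    have hcard : (s.card : ℝ) ≤ r := by
      have := Finset.card_le_card (Finset.mem_powerset.1 hs)
      rw [Finset.card_range] at this
      exact_mod_cast this
    have hsum : ∑ j ∈ s, h j ≤ r * η := by
      refine (Finset.sum_le_card_nsmul s h η fun j hj => (hmem s hs j hj).2).trans ?_
      rw [nsmul_eq_mul]
      gcongr
    have hsum0 : 0 ≤ ∑ j ∈ s, h j := Finset.sum_nonneg fun j hj => (hmem s hs j hj).1.le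
    have hσ0 : 0 < σ s := Finset.sum_pos (fun j hj => div_pos (hmem s hs j hj).1 (by positivity)) hne
    have hσ1 : σ s ≤ ∑ j ∈ s, h j := Finset.sum_le_sum fun j hj =>
      div_le_self (hmem s hs j hj).1.le (by linarith [(Nat.cast_nonneg j : (0 : ℝ) ≤ j)])
    have hrσ : r * σ s ≤ r ^ 2 * η := by
      calc r * σ s ≤ r * (r * η) := by gcongr; linarith
        _ = r ^ 2 * η := by ring
    have hrσ0 : 0 ≤ r * σ s := by positivity
    -- The base point moves back by at most r²η, and neither it nor the far end, displaced by ∑ h j,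
    -- moves forward by more than rη: hence the margins demanded of `lo` and `hi`.
    refine (normOn_comp_add_le _ fun x hx => ?_).trans (hω (σ s) ⟨hσ0, by linarith⟩)
    have hrη : 0 ≤ r * η := by positivity
    have hlo0 : 0 ≤ lo := by linarith
    refine ⟨add_smul_mem_box b z₀ hx (fun _ => hlo0) (fun _ => by linarith) (by linarith)
      (by linarith), ?_⟩
    rw [add_assoc, ← add_smul]
    exact add_smul_mem_box b z₀ hx (fun _ => hlo0) (fun _ => by linarith) (by linarith)
      (by linarith)
  refine (Finset.sum_le_card_nsmul _ _ _ hone).trans (le_of_eq ?_)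
  rw [Finset.card_powerset, Finset.card_range, nsmul_eq_mul]
  simp

end Shifts

/-! ### Mixed differences of monomials -/

section Monomials

variable {n : ℕ} {p : ℝ≥0∞}

/-- The difference with step `h` of a polynomial. -/
noncomputable def polyDiff (h : ℝ) (P : Polynomial ℝ) : Polynomial ℝ := Polynomial.taylor h P - P

theorem eval_polyDiff (h t : ℝ) (P : Polynomial ℝ) :
    (polyDiff h P).eval t = P.eval (t + h) - P.eval t := by
  simp [polyDiff, Polynomial.taylor_eval]

/-- The m-th Taylor coefficient at h is the m-th Hasse derivative there, which is constant for m > K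
and of degree at most one for m = K. -/
theorem coeff_polyDiff {K : ℕ} (h : ℝ) {P : Polynomial ℝ} (hP : P.natDegree ≤ K + 1) :
    (polyDiff h P).natDegree ≤ K ∧
      (polyDiff h P).coeff K = (K + 1) * h * P.coeff (K + 1) := by
  have hz : ∀ m, K + 1 < m → P.coeff m = 0 := fun m hm =>
    Polynomial.coeff_eq_zero_of_natDegree_lt (hP.trans_lt hm)
  constructor
  · rw [Polynomial.natDegree_le_iff_coeff_eq_zero]
    intro m hm
    have : Polynomial.hasseDeriv m P = Polynomial.C (P.coeff m) := by
      ext k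
      rw [Polynomial.hasseDeriv_coeff, Polynomial.coeff_C]
      split_ifs with hk
      · simp [hk]
      · rw [hz (k + m) (by omega), mul_zero]
    rw [polyDiff, Polynomial.coeff_sub, Polynomial.taylor_coeff, this, Polynomial.eval_C, sub_self]
  · have : Polynomial.hasseDeriv K P =
        Polynomial.C (P.coeff K) + Polynomial.C ((K + 1) * P.coeff (K + 1)) * Polynomial.X := by
      ext k
      rw [Polynomial.hasseDeriv_coeff, Polynomial.coeff_add, Polynomial.coeff_C,
        Polynomial.coeff_C_mul, Polynomial.coeff_X]
      rcases k with _ | _ | k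
      · simp
      · rw [zero_add, add_comm 1 K, Nat.choose_succ_self_right]
        simp
      · rw [hz (k + 1 + 1 + K) (by omega)]
        simp
    rw [polyDiff, Polynomial.coeff_sub, Polynomial.taylor_coeff, this]
    simp only [Polynomial.eval_add, Polynomial.eval_C, Polynomial.eval_mul, Polynomial.eval_X]
    ring

theorem polyDiff_eq_zero (h : ℝ) {P : Polynomial ℝ} (hP : P.natDegree = 0) : polyDiff h P = 0 := by
  rw [Polynomial.natDegree_eq_zero] at hP
  obtain ⟨c, rfl⟩ := hP
  simp [polyDiff]

variable (b : Module.Basis (Fin n) ℝ (EuclideanSpace ℝ (Fin n))) (z₀ : EuclideanSpace ℝ (Fin n))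

/-- The product of polynomials in the single coordinates. -/
noncomputable def prodPoly (P : Fin n → Polynomial ℝ) (z : EuclideanSpace ℝ (Fin n)) : ℝ :=
  ∏ j, (P j).eval (coordAt b z₀ j z)

/-- The monomial with exponents `j ↦ β.count j` in the coordinates. -/
noncomputable def monomialAt (β : Multiset (Fin n)) (z : EuclideanSpace ℝ (Fin n)) : ℝ :=
  ∏ j, coordAt b z₀ j z ^ β.count j

theorem monomialAt_eq_prodPoly (β : Multiset (Fin n)) :
    monomialAt b z₀ β = prodPoly b z₀ (fun j => Polynomial.X ^ β.count j) := by
  funext z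
  simp [monomialAt, prodPoly]

theorem continuous_monomialAt (β : Multiset (Fin n)) : Continuous (monomialAt b z₀ β) :=
  continuous_finsetProd _ fun j _ => (continuous_coordAt b z₀ j).pow _

theorem prodPoly_eq_zero {P : Fin n → Polynomial ℝ} {i : Fin n} (h : P i = 0) :
    prodPoly b z₀ P = 0 := by
  funext z
  exact Finset.prod_eq_zero (Finset.mem_univ i) (by simp [h])

theorem prodPoly_diff (P : Fin n → Polynomial ℝ) (i : Fin n) (h : ℝ) :
    (fun z => prodPoly b z₀ P (z + h • b i) - prodPoly b z₀ P z) =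
      prodPoly b z₀ (Function.update P i (polyDiff h (P i))) := by
  funext z
  simp only [prodPoly]
  rw [← Finset.mul_prod_erase _ _ (Finset.mem_univ i), ← Finset.mul_prod_erase _ _ (Finset.mem_univ i),
    ← Finset.mul_prod_erase _ _ (Finset.mem_univ i)]
  have h1 : ∏ x ∈ Finset.univ.erase i, (P x).eval (coordAt b z₀ x (z + h • b i)) =
      ∏ x ∈ Finset.univ.erase i, (P x).eval (coordAt b z₀ x z) := by
    refine Finset.prod_congr rfl fun x hx => ?_
    rw [coordAt_add_smul, if_neg (Finset.ne_of_mem_erase hx).symm, add_zero]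
  have h2 : ∏ x ∈ Finset.univ.erase i,
      (Function.update P i (polyDiff h (P i)) x).eval (coordAt b z₀ x z) =
      ∏ x ∈ Finset.univ.erase i, (P x).eval (coordAt b z₀ x z) := by
    refine Finset.prod_congr rfl fun x hx => ?_
    rw [Function.update_of_ne (Finset.ne_of_mem_erase hx)]
  rw [h1, h2, Function.update_self, eval_polyDiff, coordAt_add_smul, if_pos rfl]
  ring

/-- A step in direction i affects only the i-th factor and lowers its degree until it is constant;
one more step kills it. -/
theorem mixedDiff_prodPoly_eq_zero (m : Multiset (Fin n × ℝ)) (P : Fin n → Polynomial ℝ) (i : Fin n)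
    (h : (P i).natDegree < (m.map Prod.fst).count i) :
    shiftAlg n (mixedDiff b m) (prodPoly b z₀ P) = 0 := by
  induction m using Multiset.induction_on generalizing P with
  | empty => simp at h
  | cons a m ih =>
    rw [shiftAlg_mixedDiff_cons', prodPoly_diff]
    rw [Multiset.map_cons, Multiset.count_cons] at h
    by_cases hi : i = a.1
    · rw [if_pos hi] at h
      subst hi
      rcases Nat.eq_zero_or_pos (P a.1).natDegree with h0 | h0
      · rw [prodPoly_eq_zero b z₀ (i := a.1) (by simp [polyDiff_eq_zero _ h0]), map_zero]
      · refine ih _ ?_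
        rw [Function.update_self]
        have := (coeff_polyDiff (K := (P a.1).natDegree - 1) a.2 (P := P a.1) (by omega)).1
        omega
    · rw [if_neg hi, add_zero] at h
      refine ih _ ?_
      rwa [Function.update_of_ne hi]

/-- A step s in direction i turns the coefficient of order k + 1 of the i-th factor into (k + 1)s
times itself, now in order k. These factors accumulate to the factorials and the product of the
steps. -/
theorem mixedDiff_prodPoly_eq_const (m : Multiset (Fin n × ℝ)) (P : Fin n → Polynomial ℝ)
    (h : ∀ i, (P i).natDegree ≤ (m.map Prod.fst).count i) :
    shiftAlg n (mixedDiff b m) (prodPoly b z₀ P) = fun _ =>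
      (∏ j, (((m.map Prod.fst).count j).factorial : ℝ) * (P j).coeff ((m.map Prod.fst).count j)) *
        (m.map Prod.snd).prod := by
  induction m using Multiset.induction_on generalizing P with
  | empty =>
    rw [mixedDiff_zero]
    funext z
    simp only [Multiset.map_zero, Multiset.count_zero, Nat.factorial_zero, Nat.cast_one, one_mul,
      Multiset.prod_zero, mul_one, prodPoly]
    refine Finset.prod_congr rfl fun j _ => ?_
    have := h j
    rw [Multiset.map_zero, Multiset.count_zero] at this
    rw [Polynomial.eq_C_of_natDegree_le_zero this]
    simp
  | cons a m ih =>
    rw [shiftAlg_mixedDiff_cons', prodPoly_diff]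
    simp only [Multiset.map_cons, Multiset.count_cons, Multiset.prod_cons] at h ⊢
    have ha := h a.1
    rw [if_pos rfl] at ha
    have hd := coeff_polyDiff a.2 ha
    rw [ih]
    · funext _
      rw [← Finset.mul_prod_erase _ _ (Finset.mem_univ a.1),
        ← Finset.mul_prod_erase _ _ (Finset.mem_univ a.1)]
      have h1 : ∏ x ∈ Finset.univ.erase a.1, (((m.map Prod.fst).count x).factorial : ℝ) *
          (Function.update P a.1 (polyDiff a.2 (P a.1)) x).coeff ((m.map Prod.fst).count x) =
          ∏ x ∈ Finset.univ.erase a.1,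
            ((((m.map Prod.fst).count x + if x = a.1 then 1 else 0)).factorial : ℝ) *
              (P x).coeff ((m.map Prod.fst).count x + if x = a.1 then 1 else 0) := by
        refine Finset.prod_congr rfl fun x hx => ?_
        rw [Function.update_of_ne (Finset.ne_of_mem_erase hx), if_neg (Finset.ne_of_mem_erase hx),
          add_zero]
      rw [h1, Function.update_self, hd.2, if_pos rfl, Nat.factorial_succ]
      push_cast
      ring
    · intro i
      by_cases hi : i = a.1
      · subst hi
        rw [Function.update_self]
        exact hd.1
      · rw [Function.update_of_ne hi]
        have := h i
        rwa [if_neg hi, add_zero] at this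

theorem mixedDiff_monomialAt_eq_zero {m : Multiset (Fin n × ℝ)} {β : Multiset (Fin n)}
    (h : ¬ m.map Prod.fst ≤ β) : shiftAlg n (mixedDiff b m) (monomialAt b z₀ β) = 0 := by
  rw [Multiset.le_iff_count] at h
  push Not at h
  obtain ⟨i, hi⟩ := h
  rw [monomialAt_eq_prodPoly]
  exact mixedDiff_prodPoly_eq_zero b z₀ m _ i (by simpa using hi)

theorem mixedDiff_monomialAt {m : Multiset (Fin n × ℝ)} {β : Multiset (Fin n)}
    (h : m.map Prod.fst = β) : shiftAlg n (mixedDiff b m) (monomialAt b z₀ β) = fun _ =>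
      (∏ j, ((β.count j).factorial : ℝ)) * (m.map Prod.snd).prod := by
  rw [monomialAt_eq_prodPoly, mixedDiff_prodPoly_eq_const b z₀ m _ (by simp [h])]
  simp [h]

end Monomials

/-! ### Stability of additive and multilinear functions -/

section Additive

/-- A bounded approximately additive function on an interval `(0, η]` is nearly linear. -/
theorem abs_sub_linear_le {a : ℝ → ℝ} {η ε B : ℝ} (hη : 0 < η) (hB : ∀ s ∈ Ioc 0 η, |a s| ≤ B)
    (hadd : ∀ s t, 0 < s → 0 < t → s + t ≤ η → |a (s + t) - a s - a t| ≤ ε) {s : ℝ}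
    (hs : s ∈ Ioc 0 η) : |a s - s / η * a η| ≤ 3 * ε := by
  set c : ℝ → ℝ := fun s => a s - s / η * a η with hc
  have cη : c η = 0 := by simp [hc, hη.ne']
  have cadd : ∀ s t, 0 < s → 0 < t → s + t ≤ η → |c (s + t) - c s - c t| ≤ ε := by
    intro s t h1 h2 h3
    have : c (s + t) - c s - c t = a (s + t) - a s - a t := by simp only [hc]; ring
    rw [this]
    exact hadd s t h1 h2 h3
  have hε : 0 ≤ ε := (abs_nonneg _).trans (hadd (η / 2) (η / 2) (by linarith) (by linarith)
    (by linarith))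
  -- Up to η/2, c (2s) is nearly 2 c s; beyond η/2, c s is nearly -c (η - s) because c η = 0. The
  -- map M ↦ M/2 + 3ε/2 has fixed point 3ε, so iterating it eliminates the a priori bound B.
  have half : ∀ M, (∀ s ∈ Ioc 0 η, |c s| ≤ M) → ∀ s ∈ Ioc 0 η, |c s| ≤ M / 2 + 3 / 2 * ε := by
    intro M hM
    have small : ∀ s, 0 < s → s ≤ η / 2 → |c s| ≤ M / 2 + ε / 2 := by
      intro s h1 h2
      have h3 := cadd s s h1 h1 (by linarith)
      have h4 := hM (s + s) ⟨by linarith, by linarith⟩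
      rw [abs_le] at h3 h4 ⊢
      constructor <;> linarith
    intro s hs
    rcases le_or_gt s (η / 2) with h | h
    · linarith [small s hs.1 h]
    rcases hs.2.eq_or_lt with h' | h'
    · rw [h', cη, abs_zero]
      have := (abs_nonneg _).trans (hM s hs)
      positivity
    · have h3 := cadd s (η - s) hs.1 (by linarith) (by linarith)
      have h4 := small (η - s) (by linarith) (by linarith)
      rw [add_sub_cancel, cη] at h3
      rw [abs_le] at h3 h4 ⊢
      constructor <;> linarith
  have hB0 : ∀ s ∈ Ioc 0 η, |c s| ≤ B + B := by
    intro s hs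
    have h1 := hB s hs
    have h2 := hB η ⟨hη, le_rfl⟩
    have h3 : |s / η * a η| ≤ B := by
      rw [abs_mul, abs_of_nonneg (div_nonneg hs.1.le hη.le)]
      have : s / η ≤ 1 := (div_le_one hη).2 hs.2
      have h0 : 0 ≤ |a η| := abs_nonneg _
      nlinarith
    exact (abs_sub _ _).trans (add_le_add h1 h3)
  have iter : ∀ k : ℕ, ∀ s ∈ Ioc 0 η, |c s| ≤ 3 * ε + (B + B) * (1 / 2) ^ k := by
    intro k
    induction k with
    | zero =>
      intro s hs
      simpa using (hB0 s hs).trans (by linarith)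
    | succ k ih =>
      intro s hs
      refine (half _ ih s hs).trans (le_of_eq ?_)
      rw [pow_succ]
      ring
  have hlim : Filter.Tendsto (fun k : ℕ => 3 * ε + (B + B) * (1 / 2 : ℝ) ^ k) Filter.atTop
      (nhds (3 * ε + (B + B) * 0)) :=
    ((tendsto_pow_atTop_nhds_zero_of_lt_one (by norm_num) (by norm_num)).const_mul _).const_add _
  have := ge_of_tendsto' hlim fun k => iter k s hs
  simpa using this

/-- A bounded function of finitely many steps which is approximately additive in each of them is
nearly multilinear. -/
theorem abs_sub_multilinear_le {ι : Type*} {a : Multiset (ι × ℝ) → ℝ} {η ε B : ℝ} (hη : 0 < η)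
    {β : Multiset ι}
    (hB : ∀ m : Multiset (ι × ℝ), m.map Prod.fst = β → (∀ x ∈ m, x.2 ∈ Ioc 0 η) → |a m| ≤ B)
    (hadd : ∀ (i : ι) (s t : ℝ) (m : Multiset (ι × ℝ)), 0 < s → 0 < t → s + t ≤ η →
      i ::ₘ m.map Prod.fst = β → (∀ x ∈ m, x.2 ∈ Ioc 0 η) →
      |a ((i, s + t) ::ₘ m) - a ((i, s) ::ₘ m) - a ((i, t) ::ₘ m)| ≤ ε)
    (m m' : Multiset (ι × ℝ)) (hm : (m + m').map Prod.fst = β)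
    (hm' : ∀ x ∈ m + m', x.2 ∈ Ioc 0 η) :
    |a (m + m') - (m.map fun x => x.2 / η).prod * a (m.map (fun x => (x.1, η)) + m')| ≤
      Multiset.card m * (3 * ε) := by
  -- The steps of m are replaced by η one by one and moved into m'. The factors s/η are at most 1,
  -- so the errors 3ε merely add up.
  induction m using Multiset.induction_on generalizing m' with
  | empty => simp
  | cons x m ih =>
    obtain ⟨i, s⟩ := x
    have hs : s ∈ Ioc 0 η := hm' (i, s) (by simp)
    have hrest : ∀ x ∈ m + m', x.2 ∈ Ioc 0 η := fun x hx => hm' x (by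
      rw [Multiset.cons_add]; exact Multiset.mem_cons_of_mem hx)
    have hfst : i ::ₘ (m + m').map Prod.fst = β := by
      rw [← hm, Multiset.cons_add, Multiset.map_cons]
    have h1 : |a ((i, s) ::ₘ (m + m')) - s / η * a ((i, η) ::ₘ (m + m'))| ≤ 3 * ε := by
      refine abs_sub_linear_le (a := fun s => a ((i, s) ::ₘ (m + m'))) (B := B) hη
        (fun t ht => hB _ (by simpa using hfst) fun x hx => ?_)
        (fun t u ht hu htu => hadd i t u _ ht hu htu hfst hrest) hs
      rcases Multiset.mem_cons.1 hx with rfl | hx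
      · exact ht
      · exact hrest x hx
    have hcomm : m + (i, η) ::ₘ m' = (i, η) ::ₘ (m + m') := Multiset.add_cons _ _ _
    have h2 := ih ((i, η) ::ₘ m') (by rw [hcomm, Multiset.map_cons]; exact hfst) (by
      rw [hcomm]
      intro x hx
      rcases Multiset.mem_cons.1 hx with rfl | hx
      · exact ⟨hη, le_rfl⟩
      · exact hrest x hx)
    rw [hcomm, Multiset.add_cons] at h2
    simp only [Multiset.cons_add, Multiset.map_cons, Multiset.prod_cons, Multiset.card_cons]
    set u := a ((i, η) ::ₘ (m + m'))
    set w := (m.map fun x => x.2 / η).prod * a ((i, η) ::ₘ (m.map (fun x => (x.1, η)) + m')) with hw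
    have hsη : s / η ≤ 1 := (div_le_one hη).2 hs.2
    have hsη0 : 0 ≤ s / η := div_nonneg hs.1.le hη.le
    have h3 : |s / η * (u - w)| ≤ Multiset.card m * (3 * ε) := by
      rw [abs_mul, abs_of_nonneg hsη0]
      exact (mul_le_of_le_one_left (abs_nonneg _) hsη).trans h2
    have h4 : a ((i, s) ::ₘ (m + m')) - s / η * (m.map fun x => x.2 / η).prod *
        a ((i, η) ::ₘ (m.map (fun x => (x.1, η)) + m')) =
        (a ((i, s) ::ₘ (m + m')) - s / η * u) + s / η * (u - w) := by
      rw [hw]; ring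
    rw [h4]
    refine (abs_add_le _ _).trans ((add_le_add h1 h3).trans (le_of_eq ?_))
    push_cast
    ring

end Additive

/-! ### Whitney's inequality on a small cube: removing monomials from the top -/

section Whitney

variable {n : ℕ} {p : ℝ≥0∞}

/-- All mixed differences of `f` of order at most `M`, with steps at most `η` and with the multiset of
directions outside `Λ`, have norm at most `ε` on a cube of side `η`. -/
def SmallDiff (p : ℝ≥0∞) (b : Module.Basis (Fin n) ℝ (EuclideanSpace ℝ (Fin n)))
    (z₀ : EuclideanSpace ℝ (Fin n)) (lo η : ℝ) (M : ℕ) (Λ : Finset (Multiset (Fin n)))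
    (ε : ℝ≥0∞) (f : EuclideanSpace ℝ (Fin n) → ℝ) : Prop :=
  ∀ m : Multiset (Fin n × ℝ), (∀ x ∈ m, x.2 ∈ Ioc 0 η) → m.map Prod.fst ∉ Λ →
    Multiset.card m ≤ M →
      normOn p (shiftAlg n (mixedDiff b m) f) (box b z₀ (fun _ => lo) (fun _ => lo + η)) ≤ ε

theorem normOn_add_le_of_le {f g : EuclideanSpace ℝ (Fin n) → ℝ} {A : Set (EuclideanSpace ℝ (Fin n))}
    {ε : ℝ≥0∞} {s t : ℝ≥0} (hf : Adm p f) (hg : Adm p g) (h1 : normOn p f A ≤ s * ε)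
    (h2 : normOn p g A ≤ t * ε) :
    normOn p (fun x => f x + g x) A ≤ (triConst p * (s + t) : ℝ≥0) * ε := by
  refine (normOn_add_le hf hg).trans ?_
  rw [ENNReal.coe_mul, mul_assoc, ENNReal.coe_add, add_mul]
  gcongr

theorem normOn_sub_le_of_le {f g : EuclideanSpace ℝ (Fin n) → ℝ} {A : Set (EuclideanSpace ℝ (Fin n))}
    {ε : ℝ≥0∞} {s t : ℝ≥0} (hf : Adm p f) (hg : Adm p g) (h1 : normOn p f A ≤ s * ε)
    (h2 : normOn p g A ≤ t * ε) :
    normOn p (fun x => f x - g x) A ≤ (triConst p * (s + t) : ℝ≥0) * ε := by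
  refine (normOn_sub_le hf hg).trans ?_
  rw [ENNReal.coe_mul, mul_assoc, ENNReal.coe_add, add_mul]
  gcongr

theorem adm_monomialAt (b : Module.Basis (Fin n) ℝ (EuclideanSpace ℝ (Fin n)))
    (z₀ : EuclideanSpace ℝ (Fin n)) (β : Multiset (Fin n)) : Adm p (monomialAt b z₀ β) :=
  Or.inr (continuous_monomialAt b z₀ β).measurable

theorem normOn_box_ne_top_of_continuous (b : Module.Basis (Fin n) ℝ (EuclideanSpace ℝ (Fin n)))
    (z₀ : EuclideanSpace ℝ (Fin n)) (lo hi : Fin n → ℝ) {f : EuclideanSpace ℝ (Fin n) → ℝ}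
    (hf : ContinuousOn f (box b z₀ lo hi)) : normOn p f (box b z₀ lo hi) ≠ ∞ := by
  obtain ⟨M, hM⟩ := (isCompact_box b z₀ lo hi).exists_bound_of_continuousOn hf
  exact normOn_ne_top_of_bounded (measurableSet_box b z₀ lo hi).nullMeasurableSet
    (volume_box_ne_top b z₀ lo hi) M hM

/-- Subtracting a multiple of a maximal monomial of a lower set `Λ` makes the corresponding mixed
differences small. -/
theorem exists_smallDiff_sub_monomialAt (hp : 0 < p) (M : ℕ) (β : Multiset (Fin n))
    (hβM : Multiset.card β + 1 ≤ M) : ∃ C : ℝ≥0,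
    ∀ (b : Module.Basis (Fin n) ℝ (EuclideanSpace ℝ (Fin n))) (z₀ : EuclideanSpace ℝ (Fin n))
      (lo η : ℝ) (f : EuclideanSpace ℝ (Fin n) → ℝ) (ε : ℝ≥0∞) (Λ : Finset (Multiset (Fin n))),
      0 < η → Adm p f → normOn p f (box b z₀ (fun _ => lo) (fun _ => lo + η + M * η)) ≠ ∞ →
      (∀ i, i ::ₘ β ∉ Λ) → (∀ α ≤ β, α ∈ Λ) → SmallDiff p b z₀ lo η M Λ ε f →
      ∃ c : ℝ, SmallDiff p b z₀ lo η M (Λ.erase β) (C * ε)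
        (fun x => f x - c * monomialAt b z₀ β x) := by
  obtain ⟨C₁, hC₁⟩ := exists_const_normOn_sub_le (n := n) hp
  -- Error in the additivity of the constants, from Δ_{s+t} = Δ_s + Δ_t + Δ_s Δ_t: 1 for the
  -- second-order term, and C₁ for each of the three replacements of a difference by its constant.
  set K : ℝ≥0 := triConst p * (triConst p * (1 + C₁) + triConst p * (C₁ + C₁)) with hK
  set C₂ : ℝ≥0 := triConst p * (C₁ + Multiset.card β * (3 * K)) with hC₂
  refine ⟨1 + C₂, fun b z₀ lo η f ε Λ hη hf hfin hmax hlow hsmall => ?_⟩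
  set Q := box b z₀ (fun _ => lo) (fun _ => lo + η) with hQ
  set κ := normOn p (fun _ : EuclideanSpace ℝ (Fin n) => (1 : ℝ)) Q with hκ
  have hκ0 : κ ≠ 0 := normOn_one_ne_zero hp (volume_box_ne_zero _ _ _ _ fun _ => by linarith)
  have hκt : κ ≠ ∞ := normOn_one_ne_top (volume_box_ne_top _ _ _ _)
  rcases eq_or_ne ε ∞ with rfl | hεt
  · refine ⟨0, fun m _ _ _ => ?_⟩
    rw [ENNReal.mul_top (by simp)]
    exact le_top
  -- A constant t has norm |t|κ on Q, so ε' is the size of a constant of norm ε. It moves estimates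
  -- for constants into ℝ.
  set ε' : ℝ := (ε / κ).toReal with hε'
  have hεκ : ε / κ ≠ ∞ := ENNReal.div_ne_top hεt hκ0
  have real_le : ∀ (t : ℝ) (C : ℝ≥0), normOn p (fun _ => t) Q ≤ C * ε → |t| ≤ C * ε' := by
    intro t C h
    rw [normOn_const, ← hκ] at h
    have h1 : ‖t‖ₑ ≤ C * (ε / κ) := by
      rw [← mul_div_assoc]
      exact (ENNReal.le_div_iff_mul_le (Or.inl hκ0) (Or.inl hκt)).2 h
    have h2 := ENNReal.toReal_mono (ENNReal.mul_ne_top ENNReal.coe_ne_top hεκ) h1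
    simpa [ENNReal.toReal_mul, hε'] using h2
  have le_real : ∀ (t : ℝ) (C : ℝ≥0), |t| ≤ C * ε' → normOn p (fun _ => t) Q ≤ C * ε := by
    intro t C h
    rw [normOn_const, ← hκ]
    have h1 : ‖t‖ₑ ≤ C * (ε / κ) := by
      rw [Real.enorm_eq_ofReal_abs]
      refine (ENNReal.ofReal_le_ofReal h).trans (le_of_eq ?_)
      rw [ENNReal.ofReal_mul (by positivity), ENNReal.ofReal_coe_nnreal, hε',
        ENNReal.ofReal_toReal hεκ]
    calc ‖t‖ₑ * κ ≤ C * (ε / κ) * κ := by gcongr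
      _ = C * ε := by rw [mul_assoc, ENNReal.div_mul_cancel hκ0 hκt]
  have hadm : ∀ m, Adm p (shiftAlg n (mixedDiff b m) f) := fun m => adm_shiftAlg_mixedDiff b m hf
  have hcard : ∀ m : Multiset (Fin n × ℝ), m.map Prod.fst = β → Multiset.card m = Multiset.card β := by
    intro m hm
    rw [← hm, Multiset.card_map]
  have hex : ∀ m : Multiset (Fin n × ℝ), ∃ a : ℝ, m.map Prod.fst = β → (∀ x ∈ m, x.2 ∈ Ioc 0 η) →
      normOn p (fun x => shiftAlg n (mixedDiff b m) f x - a) Q ≤ C₁ * ε := by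
    intro m
    by_cases hm : m.map Prod.fst = β ∧ ∀ x ∈ m, x.2 ∈ Ioc 0 η
    · obtain ⟨a, ha⟩ := hC₁ b z₀ lo η (shiftAlg n (mixedDiff b m) f) ε hη (hadm m) fun i h hh => by
        have := hsmall ((i, h) ::ₘ m) (fun x hx => by
          rcases Multiset.mem_cons.1 hx with rfl | hx
          · exact hh
          · exact hm.2 x hx) (by rw [Multiset.map_cons, hm.1]; exact hmax i)
          (by rw [Multiset.card_cons, hcard m hm.1]; exact hβM)
        rwa [shiftAlg_mixedDiff_cons] at this
      exact ⟨a, fun _ _ => ha⟩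
    · exact ⟨0, fun h1 h2 => absurd ⟨h1, h2⟩ hm⟩
  choose a ha using hex
  -- Only the finiteness of this bound matters: it starts the Hyers–Ulam iteration and enters no
  -- constant.
  set B₀ : ℝ≥0∞ := triConst p * ((2 * triConst p : ℝ≥0∞) ^ Multiset.card β *
    normOn p f (box b z₀ (fun _ => lo) (fun _ => lo + η + M * η)) + C₁ * ε) with hB₀
  have hB₀t : B₀ ≠ ∞ := by
    refine ENNReal.mul_ne_top ENNReal.coe_ne_top (ENNReal.add_ne_top.2 ⟨ENNReal.mul_ne_top ?_ hfin,
      ENNReal.mul_ne_top ENNReal.coe_ne_top hεt⟩)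
    exact ENNReal.pow_ne_top (ENNReal.mul_ne_top (by simp) ENNReal.coe_ne_top)
  have hbound : ∀ m : Multiset (Fin n × ℝ), m.map Prod.fst = β → (∀ x ∈ m, x.2 ∈ Ioc 0 η) →
      |a m| ≤ (B₀ / κ).toReal := by
    intro m h1 h2
    have h3 : normOn p (fun _ => a m) Q ≤ B₀ := by
      have h4 := normOn_sub_le (A := Q) (hadm m) ((hadm m).sub (adm_const (a m)))
      simp only [sub_sub_cancel] at h4
      refine h4.trans ?_
      rw [hB₀]
      gcongr
      · have := normOn_mixedDiff_le b z₀ m h2 hf lo (lo + η) (lo + η + M * η) (by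
          rw [hcard m h1]
          have : (Multiset.card β : ℝ) ≤ M := by
            exact_mod_cast (Nat.le_succ _).trans hβM
          gcongr)
        rwa [hcard m h1] at this
      · exact ha m h1 h2
    rw [normOn_const, ← hκ] at h3
    have h5 := ENNReal.toReal_mono (ENNReal.div_ne_top hB₀t hκ0)
      ((ENNReal.le_div_iff_mul_le (Or.inl hκ0) (Or.inl hκt)).2 h3)
    simpa using h5
  have hadd : ∀ (i : Fin n) (s t : ℝ) (m : Multiset (Fin n × ℝ)), 0 < s → 0 < t → s + t ≤ η →
      i ::ₘ m.map Prod.fst = β → (∀ x ∈ m, x.2 ∈ Ioc 0 η) →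
      |a ((i, s + t) ::ₘ m) - a ((i, s) ::ₘ m) - a ((i, t) ::ₘ m)| ≤ K * ε' := by
    intro i s t m hs ht hst hm hmη
    have hsteps : ∀ u ∈ Ioc 0 η, ∀ x ∈ (i, u) ::ₘ m, x.2 ∈ Ioc 0 η := by
      intro u hu x hx
      rcases Multiset.mem_cons.1 hx with rfl | hx
      · exact hu
      · exact hmη x hx
    have hus : s ∈ Ioc 0 η := ⟨hs, by linarith⟩
    have hut : t ∈ Ioc 0 η := ⟨ht, by linarith⟩
    have h1 := ha ((i, s) ::ₘ m) (by simpa using hm) (hsteps s hus)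
    have h2 := ha ((i, t) ::ₘ m) (by simpa using hm) (hsteps t hut)
    have h3 := ha ((i, s + t) ::ₘ m) (by simpa using hm) (hsteps (s + t) ⟨by linarith, hst⟩)
    have h4 : normOn p (shiftAlg n (mixedDiff b ((i, s) ::ₘ (i, t) ::ₘ m)) f) Q ≤ (1 : ℝ≥0) * ε := by
      rw [ENNReal.coe_one, one_mul]
      refine hsmall _ (fun x hx => ?_) ?_ ?_
      · rcases Multiset.mem_cons.1 hx with rfl | hx
        · exact hus
        · exact hsteps t hut x hx
      · simp only [Multiset.map_cons]
        rw [hm]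
        exact hmax i
      · rw [← hm] at hβM
        simpa using hβM
    refine real_le _ _ ?_
    have h5 := normOn_add_le_of_le
      ((hadm ((i, s) ::ₘ (i, t) ::ₘ m)).sub ((hadm ((i, s + t) ::ₘ m)).sub (adm_const _)))
      (((hadm ((i, s) ::ₘ m)).sub (adm_const _)).add ((hadm ((i, t) ::ₘ m)).sub (adm_const _)))
      (normOn_sub_le_of_le (hadm _) ((hadm _).sub (adm_const _)) h4 h3)
      (normOn_add_le_of_le ((hadm _).sub (adm_const _)) ((hadm _).sub (adm_const _)) h1 h2)
    refine le_trans (le_of_eq ?_) h5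
    congr 1
    funext x
    simp only [shiftAlg_mixedDiff_cons]
    have : x + s • b i + t • b i = x + (s + t) • b i := by module
    rw [this]
    ring
  set D := a (β.map fun i => (i, η)) with hD
  set fac : ℝ := ∏ j, ((β.count j).factorial : ℝ) with hfac
  have hfac0 : fac ≠ 0 := Finset.prod_ne_zero_iff.2 fun j _ =>
    Nat.cast_ne_zero.2 (Nat.factorial_ne_zero _)
  -- With all steps equal to η, the mixed difference of the monomial is η^|β| times the product of
  -- the factorials; c matches it to D.
  set c : ℝ := D / (η ^ Multiset.card β * fac) with hc
  have hdiff : ∀ m, shiftAlg n (mixedDiff b m) (fun x => f x - c * monomialAt b z₀ β x) =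
      fun x => shiftAlg n (mixedDiff b m) f x -
        c * shiftAlg n (mixedDiff b m) (monomialAt b z₀ β) x := by
    intro m
    have : (fun x => f x - c * monomialAt b z₀ β x) = f - c • monomialAt b z₀ β := rfl
    rw [this, map_sub, map_smul]
    rfl
  refine ⟨c, fun m hmη hmΛ hmM => ?_⟩
  rw [hdiff]
  by_cases hm : m.map Prod.fst = β
  · rw [mixedDiff_monomialAt b z₀ hm]
    have h1 := abs_sub_multilinear_le hη hbound hadd m 0 (by simpa using hm) (by simpa using hmη)
    rw [add_zero, add_zero, hcard m hm] at h1
    have h2 : (m.map fun x => x.2 / η).prod * a (m.map fun x => (x.1, η)) =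
        c * (fac * (m.map Prod.snd).prod) := by
      have h3 : m.map (fun x => (x.1, η)) = β.map fun i => (i, η) := by
        rw [← hm, Multiset.map_map]
        rfl
      have h4 : (m.map fun x => x.2 / η).prod = (m.map Prod.snd).prod / η ^ Multiset.card β := by
        rw [← hcard m hm, Multiset.prod_map_div]
        simp
      rw [h3, h4, hc, ← hD]
      field_simp
    rw [h2] at h1
    have h5 := le_real _ (Multiset.card β * (3 * K)) (h1.trans (le_of_eq (by push_cast; ring)))
    have h6 := normOn_add_le_of_le ((hadm m).sub (adm_const (a m)))
      (adm_const (a m - c * (fac * (m.map Prod.snd).prod))) (ha m hm hmη) h5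
    simp only [sub_add_sub_cancel] at h6
    refine h6.trans ?_
    gcongr
    exact le_add_self
  · have hmΛ' : m.map Prod.fst ∉ Λ := fun h => hmΛ (Finset.mem_erase.2 ⟨hm, h⟩)
    -- Λ contains everything below β, so directions outside Λ are not below β and the difference
    -- annihilates the monomial.
    rw [mixedDiff_monomialAt_eq_zero b z₀ fun h => hmΛ' (hlow _ h)]
    simp only [Pi.zero_apply, mul_zero, sub_zero]
    refine (hsmall m hmη hmΛ' hmM).trans ?_
    rw [ENNReal.coe_add, add_mul, ENNReal.coe_one, one_mul]
    exact le_self_add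

/-- If all mixed differences outside a lower set are small, the function is nearly a combination of
the monomials of the lower set. -/
theorem exists_normOn_sub_sum_monomialAt_le (hp : 0 < p) (M : ℕ) (Λ : Finset (Multiset (Fin n)))
    (hlow : ∀ β ∈ Λ, ∀ α ≤ β, α ∈ Λ) (hM : ∀ β ∈ Λ, Multiset.card β + 1 ≤ M) : ∃ C : ℝ≥0,
    ∀ (b : Module.Basis (Fin n) ℝ (EuclideanSpace ℝ (Fin n))) (z₀ : EuclideanSpace ℝ (Fin n))
      (lo η : ℝ) (f : EuclideanSpace ℝ (Fin n) → ℝ) (ε : ℝ≥0∞),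
      0 < η → Adm p f → normOn p f (box b z₀ (fun _ => lo) (fun _ => lo + η + M * η)) ≠ ∞ →
      SmallDiff p b z₀ lo η M Λ ε f →
      ∃ c : Multiset (Fin n) → ℝ, normOn p (fun x => f x - ∑ β ∈ Λ, c β * monomialAt b z₀ β x)
        (box b z₀ (fun _ => lo) (fun _ => lo + η)) ≤ C * ε := by
  classical
  induction hk : Λ.card generalizing Λ with
  | zero =>
    rw [Finset.card_eq_zero] at hk
    subst hk
    refine ⟨1, fun b z₀ lo η f ε hη hf hfin hsmall => ⟨0, ?_⟩⟩
    -- With Λ empty, the empty mixed difference is among the small ones, and it is f itself.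
    have := hsmall 0 (by simp) (by simp) (by simp)
    rw [mixedDiff_zero] at this
    simpa using this
  | succ k ih =>
    have hne : Λ.Nonempty := Finset.card_pos.1 (by omega)
    obtain ⟨β, hβ, hβmax⟩ := Finset.exists_max_image Λ Multiset.card hne
    obtain ⟨C₁, hC₁⟩ := exists_smallDiff_sub_monomialAt (n := n) hp M β (hM β hβ)
    -- Erasing an element of maximal cardinality leaves a lower set.
    obtain ⟨C₂, hC₂⟩ := ih (Λ.erase β) (fun γ hγ α hα => Finset.mem_erase.2 ⟨fun h => by
        subst h
        have h1 := Finset.mem_erase.1 hγ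
        have h2 := Multiset.card_le_card hα
        exact h1.1 (Multiset.eq_of_le_of_card_le hα (hβmax γ h1.2)).symm,
        hlow γ (Finset.mem_of_mem_erase hγ) α hα⟩)
      (fun γ hγ => hM γ (Finset.mem_of_mem_erase hγ)) (by
        rw [Finset.card_erase_of_mem hβ, hk]; rfl)
    refine ⟨C₂ * C₁, fun b z₀ lo η f ε hη hf hfin hsmall => ?_⟩
    obtain ⟨c, hc⟩ := hC₁ b z₀ lo η f ε Λ hη hf hfin (fun i hi => by
      have := hβmax _ hi
      rw [Multiset.card_cons] at this
      omega) (hlow β hβ) hsmall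
    have hmon := (adm_monomialAt (p := p) b z₀ β).const_mul c
    obtain ⟨c', hc'⟩ := hC₂ b z₀ lo η (fun x => f x - c * monomialAt b z₀ β x) (C₁ * ε) hη
      (hf.sub hmon) (by
        refine ne_top_of_le_ne_top ?_ (normOn_sub_le hf hmon)
        refine ENNReal.mul_ne_top ENNReal.coe_ne_top (ENNReal.add_ne_top.2 ⟨hfin, ?_⟩)
        exact normOn_box_ne_top_of_continuous b z₀ _ _
          ((continuous_monomialAt b z₀ β).const_mul c).continuousOn) hc
    refine ⟨Function.update c' β c, ?_⟩
    rw [ENNReal.coe_mul, mul_assoc]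
    refine le_trans (le_of_eq ?_) hc'
    congr 1
    funext x
    rw [← Finset.add_sum_erase _ _ hβ, Function.update_self]
    have : ∑ γ ∈ Λ.erase β, Function.update c' β c γ * monomialAt b z₀ γ x =
        ∑ γ ∈ Λ.erase β, c' γ * monomialAt b z₀ γ x :=
      Finset.sum_congr rfl fun γ hγ => by
        rw [Function.update_of_ne (Finset.ne_of_mem_erase hγ)]
    rw [this]
    ring

end Whitney

/-! ### Extension across slabs, and Whitney's inequality on the unit cube -/

section Extension

variable {n : ℕ} {p : ℝ≥0∞}

/-- The estimate for an r-th difference G solved for one end value F z. The free data a, u, w, v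
allow both the upper and the lower end; 2^r bounds the binomial coefficients. -/
theorem normOn_le_of_eq_sub_sum {r : ℕ} {F G : EuclideanSpace ℝ (Fin n) → ℝ}
    {U A B : Set (EuclideanSpace ℝ (Fin n))} {ω : ℝ≥0∞} (hF : Adm p F) (hG : Adm p G)
    (a : ℝ) (ha : ‖a‖ₑ = 1) (u : EuclideanSpace ℝ (Fin n)) (w : ℕ → ℝ) (hw : ∀ j, |w j| ≤ 2 ^ r)
    (v : ℕ → EuclideanSpace ℝ (Fin n))
    (hFG : ∀ z, F z = a * G (z + u) - ∑ j ∈ Finset.range r, w j * F (z + v j))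
    (hA : ∀ z ∈ U, z + u ∈ A) (hB : ∀ z ∈ U, ∀ j < r, z + v j ∈ B) (hω : normOn p G A ≤ ω) :
    normOn p F U ≤ (triConst p * (1 + triConst p ^ r * (r * 2 ^ r)) : ℝ≥0) * (normOn p F B + ω) := by
  have h1 : normOn p (fun z => a * G (z + u)) U ≤ ω := by
    rw [normOn_const_mul, ha, one_mul]
    exact (normOn_comp_add_le u hA).trans hω
  have hadm : ∀ j ∈ Finset.range r, Adm p (fun z => w j * F (z + v j)) :=
    fun j _ => (hF.comp_add _).const_mul _
  have h2 : normOn p (fun z => ∑ j ∈ Finset.range r, w j * F (z + v j)) U ≤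
      (triConst p : ℝ≥0∞) ^ r * (r * (2 ^ r * normOn p F B)) := by
    refine (normOn_sum_le _ hadm).trans ?_
    rw [Finset.card_range]
    gcongr
    refine (Finset.sum_le_card_nsmul _ _ (2 ^ r * normOn p F B) fun j hj => ?_).trans ?_
    · rw [normOn_const_mul]
      refine mul_le_mul' ?_ (normOn_comp_add_le _ fun z hz => hB z hz j (Finset.mem_range.1 hj))
      rw [Real.enorm_eq_ofReal_abs]
      refine (ENNReal.ofReal_le_ofReal (hw j)).trans (le_of_eq ?_)
      rw [ENNReal.ofReal_pow (by norm_num)]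
      simp
    · rw [Finset.card_range, nsmul_eq_mul]
  have h3 := normOn_sub_le (A := U) ((hG.comp_add u).const_mul a) (adm_sum _ hadm)
  have h4 : F = fun z => a * G (z + u) - ∑ j ∈ Finset.range r, w j * F (z + v j) := funext hFG
  calc normOn p F U = normOn p (fun z => a * G (z + u) -
        ∑ j ∈ Finset.range r, w j * F (z + v j)) U := by rw [← h4]
    _ ≤ _ := h3
    _ ≤ triConst p * (ω + (triConst p : ℝ≥0∞) ^ r * (r * (2 ^ r * normOn p F B))) := by gcongr
    _ ≤ triConst p * ((1 + (triConst p : ℝ≥0∞) ^ r * (r * 2 ^ r)) * (normOn p F B + ω)) := by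
        gcongr
        rw [add_mul, one_mul]
        refine add_le_add le_add_self ?_
        rw [mul_assoc, mul_assoc]
        gcongr
        exact le_self_add
    _ = _ := by push_cast; ring

/-- A function whose differences in the direction of one edge are small on a set `Ω` is controlled
on `Ω` by its values on a slab which meets every line in that direction that meets `Ω`. -/
theorem normOn_le_slab (r : ℕ) (ρ h R : ℝ) (hρ : 0 < ρ) (hh : 0 < h) (hrh : r * h ≤ 2 * ρ) :
    ∃ C : ℝ≥0,
    ∀ (b : Module.Basis (Fin n) ℝ (EuclideanSpace ℝ (Fin n))) (z₀ : EuclideanSpace ℝ (Fin n))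
      (i : Fin n) (Ω : Set (EuclideanSpace ℝ (Fin n))) (c : ℝ) (F : EuclideanSpace ℝ (Fin n) → ℝ)
      (ω : ℝ≥0∞), Adm p F → (∀ z ∈ Ω, |coordAt b z₀ i z - c| ≤ R) →
      (∀ z ∈ Ω, ∀ t : ℝ, |coordAt b z₀ i z + t - c| ≤ ρ → z + t • b i ∈ Ω) →
      (∀ z ∈ Ω, ∀ t : ℝ, z + t • b i ∈ Ω → ∀ s ∈ uIcc 0 t, z + s • b i ∈ Ω) →
      normOn p (shiftAlg n ((shift (h • b i) - 1) ^ r) F) {z | z ∈ Ω ∧ z + (r * h) • b i ∈ Ω} ≤ ω →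
      normOn p F Ω ≤ C * (normOn p F {z | z ∈ Ω ∧ |coordAt b z₀ i z - c| ≤ ρ} + ω) := by
  obtain ⟨Cu, hCu⟩ := normOn_union_le (n := n) (p := p)
  have main : ∀ k : ℕ, ∃ C : ℝ≥0,
    ∀ (b : Module.Basis (Fin n) ℝ (EuclideanSpace ℝ (Fin n))) (z₀ : EuclideanSpace ℝ (Fin n))
      (i : Fin n) (Ω : Set (EuclideanSpace ℝ (Fin n))) (c : ℝ) (F : EuclideanSpace ℝ (Fin n) → ℝ)
      (ω : ℝ≥0∞), Adm p F →
      (∀ z ∈ Ω, ∀ t : ℝ, |coordAt b z₀ i z + t - c| ≤ ρ → z + t • b i ∈ Ω) →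
      (∀ z ∈ Ω, ∀ t : ℝ, z + t • b i ∈ Ω → ∀ s ∈ uIcc 0 t, z + s • b i ∈ Ω) →
      normOn p (shiftAlg n ((shift (h • b i) - 1) ^ r) F) {z | z ∈ Ω ∧ z + (r * h) • b i ∈ Ω} ≤ ω →
      normOn p F {z | z ∈ Ω ∧ |coordAt b z₀ i z - c| ≤ ρ + k * h} ≤
        C * (normOn p F {z | z ∈ Ω ∧ |coordAt b z₀ i z - c| ≤ ρ} + ω) := by
    intro k
    induction k with
    | zero =>
      refine ⟨1, fun b z₀ i Ω c F ω _ _ _ _ => ?_⟩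
      simp only [Nat.cast_zero, zero_mul, add_zero, ENNReal.coe_one, one_mul]
      exact le_self_add
    | succ k ih =>
      obtain ⟨C, hC⟩ := ih
      set C' : ℝ≥0 := triConst p * (1 + triConst p ^ r * (r * 2 ^ r)) with hC'
      refine ⟨Cu * (C + Cu * (C' * (C + 1) + C' * (C + 1))), fun b z₀ i Ω c F ω hF hfib hconv hω => ?_⟩
      have hk := hC b z₀ i Ω c F ω hF hfib hconv hω
      set τ := coordAt b z₀ i with hτ
      set N₀ := normOn p F {z | z ∈ Ω ∧ |τ z - c| ≤ ρ} with hN₀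
      set Ωk := {z | z ∈ Ω ∧ |τ z - c| ≤ ρ + k * h} with hΩk
      set U := {z | z ∈ Ω ∧ ρ + k * h < τ z - c ∧ τ z - c ≤ ρ + (k + 1) * h} with hU
      set W := {z | z ∈ Ω ∧ ρ + k * h < c - τ z ∧ c - τ z ≤ ρ + (k + 1) * h} with hW
      have hkh : 0 ≤ k * h := by positivity
      have hjh : ∀ j : ℕ, 1 ≤ j → j ≤ r → h ≤ j * h ∧ j * h ≤ r * h := by
        intro j h1 h2
        have h1' : (1 : ℝ) ≤ j := by exact_mod_cast h1
        have h2' : (j : ℝ) ≤ r := by exact_mod_cast h2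
        exact ⟨by nlinarith, by nlinarith⟩
      -- One step down from the new layer U already reaches the level of Ωk, and since rh ≤ 2ρ even
      -- r steps do not pass below c - ρ. A point still above the central slab is in Ω because it
      -- lies between z and a point of that slab.
      have hdown : ∀ z ∈ U, ∀ j : ℕ, 1 ≤ j → j ≤ r → z + (-(j * h)) • b i ∈ Ωk := by
        rintro z ⟨hz, h1, h2⟩ j hj1 hj2
        obtain ⟨h3, h4⟩ := hjh j hj1 hj2
        have hcoord : τ (z + (-(j * h)) • b i) = τ z + -(j * h) := by
          rw [hτ, coordAt_add_smul, if_pos rfl]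
        refine ⟨?_, ?_⟩
        · rcases le_or_gt (τ z + -(j * h) - c) ρ with h5 | h5
          · exact hfib z hz _ (abs_le.2 ⟨by linarith, h5⟩)
          · refine hconv z hz (-(τ z - c - ρ)) (hfib z hz _ ?_) _ ?_
            · rw [abs_le]; constructor <;> linarith
            · rw [uIcc_of_ge (by linarith)]
              exact ⟨by linarith, by linarith⟩
        · rw [hcoord, abs_le]
          constructor <;> linarith
      have hup : ∀ z ∈ W, ∀ j : ℕ, 1 ≤ j → j ≤ r → z + (j * h) • b i ∈ Ωk := by
        rintro z ⟨hz, h1, h2⟩ j hj1 hj2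
        obtain ⟨h3, h4⟩ := hjh j hj1 hj2
        have hcoord : τ (z + (j * h) • b i) = τ z + j * h := by
          rw [hτ, coordAt_add_smul, if_pos rfl]
        refine ⟨?_, ?_⟩
        · rcases le_or_gt (c - (τ z + j * h)) ρ with h5 | h5
          · exact hfib z hz _ (abs_le.2 ⟨by linarith, by linarith⟩)
          · refine hconv z hz (c - τ z - ρ) (hfib z hz _ ?_) _ ?_
            · rw [abs_le]; constructor <;> linarith
            · rw [uIcc_of_le (by linarith)]
              exact ⟨by linarith, by linarith⟩
        · rw [hcoord, abs_le]
          constructor <;> linarith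
      have hG : Adm p (shiftAlg n ((shift (h • b i) - 1) ^ r) F) := by
        have : shiftAlg n ((shift (h • b i) - 1) ^ r) F = fun x => ∑ j ∈ Finset.range (r + 1),
            ((-1 : ℝ) ^ (r + j) * (r.choose j : ℝ)) * F (x + (j : ℝ) • h • b i) :=
          funext fun x => shiftAlg_pow_sub_one _ _ _ _
        rw [this]
        exact adm_sum _ fun j _ => (hF.comp_add _).const_mul _
      have hsgn : ∀ k : ℕ, ‖(-1 : ℝ) ^ k‖ₑ = 1 := fun k => by simp
      have hchoose : ∀ k j : ℕ, |(-1 : ℝ) ^ k * (r.choose j : ℝ)| ≤ 2 ^ r := fun k j => by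
        rw [abs_mul, abs_pow, abs_neg, abs_one, one_pow, one_mul, Nat.abs_cast]
        exact_mod_cast Nat.choose_le_two_pow r j
      have hNU : normOn p F U ≤ C' * (normOn p F Ωk + ω) := by
        refine normOn_le_of_eq_sub_sum (r := r) (A := {z | z ∈ Ω ∧ z + (r * h) • b i ∈ Ω}) hF hG 1 (by simp) ((-(r * h)) • b i)
          (fun j => (-1) ^ (r + j) * (r.choose j : ℝ)) (fun j => hchoose _ _)
          (fun j => (-((r - j : ℕ) * h)) • b i) (fun z => ?_)
          (fun z hz => ⟨?_, ?_⟩) (fun z hz j hj => hdown z hz _ (by omega) (by omega)) hω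
        · rw [one_mul, shiftAlg_pow_sub_one, Finset.sum_range_succ]
          have h1 : ∑ j ∈ Finset.range r, (-1 : ℝ) ^ (r + j) * (r.choose j : ℝ) *
              F (z + (-(r * h)) • b i + (j : ℝ) • h • b i) = ∑ j ∈ Finset.range r,
              (-1 : ℝ) ^ (r + j) * (r.choose j : ℝ) * F (z + (-((r - j : ℕ) * h)) • b i) := by
            refine Finset.sum_congr rfl fun j hj => ?_
            rw [Nat.cast_sub (Finset.mem_range.1 hj).le]
            congr 2
            module
          have h2 : z + (-(r * h)) • b i + (r : ℝ) • h • b i = z := by module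
          rw [h1, h2, Nat.choose_self, ← two_mul, pow_mul]
          simp
        · rcases Nat.eq_zero_or_pos r with hr0 | hr0
          · simpa [hr0] using hz.1
          · exact (hdown z hz r hr0 le_rfl).1
        · have : z + (-(r * h)) • b i + (r * h) • b i = z := by module
          rw [this]
          exact hz.1
      -- Below the slab F z is the term j = 0 of the difference based at z itself; hence the sign
      -- (-1)^r and the shifted index.
      have hNW : normOn p F W ≤ C' * (normOn p F Ωk + ω) := by
        refine normOn_le_of_eq_sub_sum (r := r) (A := {z | z ∈ Ω ∧ z + (r * h) • b i ∈ Ω}) hF hG ((-1) ^ r) (hsgn r) 0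
          (fun j => (-1) ^ (j + 1) * (r.choose (j + 1) : ℝ)) (fun j => hchoose _ _)
          (fun j => ((j + 1 : ℕ) * h) • b i) (fun z => ?_)
          (fun z hz => ?_) (fun z hz j hj => hup z hz _ (by omega) (by omega)) hω
        · rw [add_zero, shiftAlg_pow_sub_one, Finset.sum_range_succ', mul_add, Finset.mul_sum]
          have h0 : (-1 : ℝ) ^ r * (-1) ^ r = 1 := by
            rw [← mul_pow]; simp
          have h1 : ∑ j ∈ Finset.range r, (-1 : ℝ) ^ r * ((-1 : ℝ) ^ (r + (j + 1)) *
              (r.choose (j + 1) : ℝ) * F (z + ((j + 1 : ℕ) : ℝ) • h • b i)) =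
              ∑ j ∈ Finset.range r, (-1 : ℝ) ^ (j + 1) * (r.choose (j + 1) : ℝ) *
                F (z + ((j + 1 : ℕ) * h) • b i) := by
            refine Finset.sum_congr rfl fun j _ => ?_
            rw [pow_add (-1 : ℝ) r, smul_smul]
            linear_combination ((-1 : ℝ) ^ (j + 1) * (r.choose (j + 1) : ℝ) *
              F (z + (((j + 1 : ℕ) : ℝ) * h) • b i)) * h0
          rw [h1]
          simp only [add_zero, Nat.choose_zero_right, Nat.cast_one, mul_one, Nat.cast_zero, zero_smul]
          linear_combination -F z * h0
        · rw [add_zero]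
          refine ⟨hz.1, ?_⟩
          rcases Nat.eq_zero_or_pos r with hr0 | hr0
          · simpa [hr0] using hz.1
          · exact (hup z hz r hr0 le_rfl).1
      have hsub : {z | z ∈ Ω ∧ |τ z - c| ≤ ρ + (k + 1 : ℕ) * h} ⊆ Ωk ∪ (U ∪ W) := by
        rintro z ⟨hz, h1⟩
        rw [abs_le] at h1
        push_cast at h1
        by_cases h2 : |τ z - c| ≤ ρ + k * h
        · exact Or.inl ⟨hz, h2⟩
        · refine Or.inr ?_
          rw [not_le, lt_abs] at h2
          rcases h2 with h2 | h2
          · exact Or.inl ⟨hz, h2, h1.2⟩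
          · exact Or.inr ⟨hz, by linarith, by linarith⟩
      have hUW : C' * (normOn p F Ωk + ω) ≤ C' * ((C + 1) * (N₀ + ω)) := by
        gcongr
        rw [add_mul, one_mul]
        exact add_le_add hk le_add_self
      calc _ ≤ normOn p F (Ωk ∪ (U ∪ W)) := normOn_mono_set hsub
        _ ≤ Cu * (normOn p F Ωk + Cu * (normOn p F U + normOn p F W)) :=
            (hCu _ _ _).trans (by gcongr; exact hCu _ _ _)
        _ ≤ Cu * (C * (N₀ + ω) + Cu * (C' * ((C + 1) * (N₀ + ω)) + C' * ((C + 1) * (N₀ + ω)))) := by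
            gcongr
            · exact hNU.trans hUW
            · exact hNW.trans hUW
        _ = _ := by push_cast; ring
  -- This many layers of thickness h exhaust Ω.
  obtain ⟨k, hk⟩ := exists_nat_ge (R / h)
  obtain ⟨C, hC⟩ := main k
  refine ⟨C, fun b z₀ i Ω c F ω hF hR hfib hconv hω => ?_⟩
  refine (normOn_mono_set fun z hz => ?_).trans (hC b z₀ i Ω c F ω hF hfib hconv hω)
  refine ⟨hz, (hR z hz).trans ?_⟩
  rw [div_le_iff₀ hh] at hk
  linarith

/-- A function on the unit cube whose differences along the edges are small is controlled by its
values on a smaller cube. -/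
theorem normOn_unit_box_le (r : ℕ) (hr : 1 ≤ r) (η : ℝ) (hη : 0 < η) (hη1 : η ≤ 1 / 2) : ∃ C : ℝ≥0,
    ∀ (b : Module.Basis (Fin n) ℝ (EuclideanSpace ℝ (Fin n))) (z₀ : EuclideanSpace ℝ (Fin n))
      (F : EuclideanSpace ℝ (Fin n) → ℝ) (ω : ℝ≥0∞), Adm p F →
      (∀ i, ∀ h ∈ Ioc (0 : ℝ) 1, normOn p (shiftAlg n ((shift (h • b i) - 1) ^ r) F)
        {z | z ∈ box b z₀ (fun _ => 0) (fun _ => 1) ∧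
          z + (r * h) • b i ∈ box b z₀ (fun _ => 0) (fun _ => 1)} ≤ ω) →
      normOn p F (box b z₀ (fun _ => 0) (fun _ => 1)) ≤
        C * (normOn p F (box b z₀ (fun _ => 1 / 2) (fun _ => 1 / 2 + η)) + ω) := by
  classical
  have hr' : (1 : ℝ) ≤ r := by exact_mod_cast hr
  have hr0 : (r : ℝ) ≠ 0 := by positivity
  obtain ⟨C₁, hC₁⟩ := normOn_le_slab (n := n) (p := p) r (η / 2) (η / r) 1 (by positivity)
    (by positivity) (by rw [mul_div_cancel₀ _ hr0]; linarith)
  -- Coordinates in s already range over [0, 1], the others still over [1/2, 1/2 + η]. Each further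
  -- coordinate is one use of `normOn_le_slab` with slab thickness η and r steps of size η/r.
  have main : ∀ s : Finset (Fin n), ∃ C : ℝ≥0,
    ∀ (b : Module.Basis (Fin n) ℝ (EuclideanSpace ℝ (Fin n))) (z₀ : EuclideanSpace ℝ (Fin n))
      (F : EuclideanSpace ℝ (Fin n) → ℝ) (ω : ℝ≥0∞), Adm p F →
      (∀ i, ∀ h ∈ Ioc (0 : ℝ) 1, normOn p (shiftAlg n ((shift (h • b i) - 1) ^ r) F)
        {z | z ∈ box b z₀ (fun _ => 0) (fun _ => 1) ∧
          z + (r * h) • b i ∈ box b z₀ (fun _ => 0) (fun _ => 1)} ≤ ω) →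
      normOn p F (box b z₀ (fun i => if i ∈ s then 0 else 1 / 2)
        (fun i => if i ∈ s then 1 else 1 / 2 + η)) ≤
        C * (normOn p F (box b z₀ (fun _ => 1 / 2) (fun _ => 1 / 2 + η)) + ω) := by
    intro s
    induction s using Finset.induction_on with
    | empty => exact ⟨1, fun b z₀ F ω _ _ => by simp⟩
    | insert i s hi ih =>
      obtain ⟨C, hC⟩ := ih
      refine ⟨C₁ * (C + 1), fun b z₀ F ω hF hω => ?_⟩
      have h1 := hC b z₀ F ω hF hω
      set N₀ := normOn p F (box b z₀ (fun _ => 1 / 2) (fun _ => 1 / 2 + η))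
      set Ω := box b z₀ (fun j => if j ∈ insert i s then 0 else 1 / 2)
        (fun j => if j ∈ insert i s then 1 else 1 / 2 + η) with hΩ
      have hΩi : ∀ z ∈ Ω, 0 ≤ coordAt b z₀ i z ∧ coordAt b z₀ i z ≤ 1 := by
        intro z hz
        simpa using hz i
      have hmem : ∀ z ∈ Ω, ∀ t, 0 ≤ coordAt b z₀ i z + t → coordAt b z₀ i z + t ≤ 1 →
          z + t • b i ∈ Ω := by
        intro z hz t h1 h2 j
        rw [coordAt_add_smul]
        by_cases hij : i = j
        · subst hij
          simpa using ⟨h1, h2⟩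
        · rw [if_neg hij, add_zero]
          exact hz j
      have hΩK : Ω ⊆ box b z₀ (fun _ => 0) (fun _ => 1) := by
        refine box_mono b z₀ (fun j => ?_) fun j => ?_
        · split_ifs <;> norm_num
        · split_ifs <;> linarith
      have hsub : {z | z ∈ Ω ∧ z + (r * (η / r)) • b i ∈ Ω} ⊆
          {z | z ∈ box b z₀ (fun _ => 0) (fun _ => 1) ∧
            z + (r * (η / r)) • b i ∈ box b z₀ (fun _ => 0) (fun _ => 1)} :=
        fun z hz => ⟨hΩK hz.1, hΩK hz.2⟩
      have h2 := hC₁ b z₀ i Ω (1 / 2 + η / 2) F ω hF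
        (fun z hz => by
          have := hΩi z hz
          rw [abs_le]
          constructor <;> linarith)
        (fun z hz t ht => by
          rw [abs_le] at ht
          exact hmem z hz t (by linarith) (by linarith))
        (fun z hz t ht u hu => by
          have h3 := hΩi z hz
          have h4 := hΩi _ ht
          rw [coordAt_add_smul, if_pos rfl] at h4
          rw [mem_uIcc] at hu
          rcases hu with hu | hu
          · exact hmem z hz u (by linarith) (by linarith)
          · exact hmem z hz u (by linarith) (by linarith))
        ((normOn_mono_set hsub).trans (hω i (η / r)
          ⟨by positivity, (div_le_self hη.le hr').trans (by linarith)⟩))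
      have h3 : {z | z ∈ Ω ∧ |coordAt b z₀ i z - (1 / 2 + η / 2)| ≤ η / 2} ⊆
          box b z₀ (fun i => if i ∈ s then 0 else 1 / 2)
            (fun i => if i ∈ s then 1 else 1 / 2 + η) := by
        rintro z ⟨hz, hz'⟩ j
        by_cases hij : j = i
        · subst hij
          rw [abs_le] at hz'
          simp only [if_neg hi]
          constructor <;> linarith
        · have := hz j
          simpa [Finset.mem_insert, hij] using this
      refine h2.trans ?_
      rw [ENNReal.coe_mul, mul_assoc]
      gcongr
      rw [ENNReal.coe_add, add_mul, ENNReal.coe_one, one_mul]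
      exact add_le_add ((normOn_mono_set h3).trans h1) le_add_self
  obtain ⟨C, hC⟩ := main Finset.univ
  exact ⟨C, fun b z₀ F ω hF hω => by simpa using hC b z₀ F ω hF hω⟩

/-- The exponents which are less than `r` in each coordinate. -/
def exponents (n r : ℕ) : Finset (Multiset (Fin n)) :=
  ((r - 1) • (Finset.univ : Finset (Fin n)).val).powerset.toFinset

theorem mem_exponents {r : ℕ} {β : Multiset (Fin n)} :
    β ∈ exponents n r ↔ ∀ i, β.count i ≤ r - 1 := by
  rw [exponents, Multiset.mem_toFinset, Multiset.mem_powerset, Multiset.le_iff_count]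
  refine forall_congr' fun i => ?_
  rw [Multiset.count_nsmul, Multiset.count_eq_one_of_mem Finset.univ.nodup (Finset.mem_univ i),
    mul_one]

theorem shiftAlg_pow_sub_one_monomialAt {r : ℕ} (hr : 1 ≤ r)
    (b : Module.Basis (Fin n) ℝ (EuclideanSpace ℝ (Fin n))) (z₀ : EuclideanSpace ℝ (Fin n))
    {β : Multiset (Fin n)} (hβ : β ∈ exponents n r) (i : Fin n) (h : ℝ) :
    shiftAlg n ((shift (h • b i) - 1) ^ r) (monomialAt b z₀ β) = 0 := by
  have h1 : (shift (h • b i) - 1) ^ r = mixedDiff b (Multiset.replicate r (i, h)) := by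
    simp [mixedDiff]
  rw [h1]
  refine mixedDiff_monomialAt_eq_zero b z₀ fun hle => ?_
  have h2 := Multiset.le_iff_count.1 hle i
  rw [Multiset.map_replicate, Multiset.count_replicate_self] at h2
  have h3 := mem_exponents.1 hβ i
  omega

/-- The approximant has degree less than r along every edge, so the error of approximation inherits
the difference bounds of f. -/
theorem shiftAlg_pow_sub_one_sub_sum {r : ℕ} (hr : 1 ≤ r)
    (b : Module.Basis (Fin n) ℝ (EuclideanSpace ℝ (Fin n))) (z₀ : EuclideanSpace ℝ (Fin n))
    (f : EuclideanSpace ℝ (Fin n) → ℝ) (c : Multiset (Fin n) → ℝ) (i : Fin n) (h : ℝ) :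
    shiftAlg n ((shift (h • b i) - 1) ^ r)
      (fun x => f x - ∑ β ∈ exponents n r, c β * monomialAt b z₀ β x) =
      shiftAlg n ((shift (h • b i) - 1) ^ r) f := by
  have : (fun x => f x - ∑ β ∈ exponents n r, c β * monomialAt b z₀ β x) =
      f - ∑ β ∈ exponents n r, c β • monomialAt b z₀ β := by
    funext x
    simp
  rw [this, map_sub, map_sum, Finset.sum_eq_zero, sub_zero]
  intro β hβ
  rw [map_smul, shiftAlg_pow_sub_one_monomialAt hr b z₀ hβ, smul_zero]

/-- **Whitney's inequality** on a parallelepiped, for differences along its edges. -/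
theorem exists_normOn_unit_box_sub_le (hp : 0 < p) (r : ℕ) (hr : 1 ≤ r) : ∃ C : ℝ≥0,
    ∀ (b : Module.Basis (Fin n) ℝ (EuclideanSpace ℝ (Fin n))) (z₀ : EuclideanSpace ℝ (Fin n))
      (f : EuclideanSpace ℝ (Fin n) → ℝ) (ω : ℝ≥0∞), Adm p f →
      normOn p f (box b z₀ (fun _ => 0) (fun _ => 1)) ≠ ∞ →
      (∀ i, ∀ h ∈ Ioc (0 : ℝ) 1, normOn p (shiftAlg n ((shift (h • b i) - 1) ^ r) f)
        {z | z ∈ box b z₀ (fun _ => 0) (fun _ => 1) ∧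
          z + (r * h) • b i ∈ box b z₀ (fun _ => 0) (fun _ => 1)} ≤ ω) →
      ∃ c : Multiset (Fin n) → ℝ,
        normOn p (fun x => f x - ∑ β ∈ exponents n r, c β * monomialAt b z₀ β x)
          (box b z₀ (fun _ => 0) (fun _ => 1)) ≤ C * ω := by
  -- The largest cardinality occurring in `exponents n r`, plus the one extra step needed to compare
  -- with constants.
  set M := n * (r - 1) + 1 with hM
  -- The small cube starts at 1/2 in each coordinate; r²η must fit below 1/2 and (1 + M + r)η above
  -- it.
  set η : ℝ := 1 / (2 * (M + 1 + r + r ^ 2)) with hη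
  have hden : (0 : ℝ) < M + 1 + r + r ^ 2 := by positivity
  have hη0 : 0 < η := by positivity
  have hηmul : (M + 1 + r + r ^ 2) * η = 1 / 2 := by
    rw [hη]; field_simp
  have hMη : 0 ≤ M * η := by positivity
  have hrη : 0 ≤ r * η := by positivity
  have hrrη : 0 ≤ r ^ 2 * η := by positivity
  have hηsum : M * η + η + r * η + r ^ 2 * η = 1 / 2 := by rw [← hηmul]; ring
  obtain ⟨C₁, hC₁⟩ := normOn_unit_box_le (n := n) (p := p) r hr η hη0 (by linarith)
  obtain ⟨C₂, hC₂⟩ := exists_normOn_sub_sum_monomialAt_le (n := n) hp M (exponents n r)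
    (fun β hβ α hα => mem_exponents.2 fun i =>
      (Multiset.le_iff_count.1 hα i).trans (mem_exponents.1 hβ i))
    (fun β hβ => by
      have h1 : β ≤ (r - 1) • (Finset.univ : Finset (Fin n)).val := by
        simpa [exponents] using hβ
      have h2 := Multiset.card_le_card h1
      rw [Multiset.card_nsmul, Finset.card_val, Finset.card_univ, Fintype.card_fin,
        mul_comm] at h2
      omega)
  obtain ⟨C₃, hC₃⟩ := normOn_mixedDiff_single_le (n := n) (p := p) r hr
  set C₄ : ℝ≥0 := (2 * triConst p) ^ M * C₃ with hC₄
  refine ⟨C₁ * (C₂ * C₄ + 1), fun b z₀ f ω hf hfin hω => ?_⟩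
  have hsmall : SmallDiff p b z₀ (1 / 2) η M (exponents n r) (C₄ * ω) f := by
    intro m hmη hmΛ hmM
    rw [mem_exponents] at hmΛ
    push Not at hmΛ
    obtain ⟨i, hi⟩ := hmΛ
    -- Of the steps in direction i, r are collected in m₂ and controlled by ω; the remaining steps
    -- m₁ are estimated crudely.
    have hcard : r ≤ Multiset.card (m.filter fun a => i = a.1) := by
      rw [Multiset.count_map] at hi
      omega
    obtain ⟨m₂, hm₂⟩ := Multiset.card_pos_iff_exists_mem.1
      ((Multiset.card_powersetCard r _).symm ▸ Nat.choose_pos hcard)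
    obtain ⟨hm₂, hm₂r⟩ := Multiset.mem_powersetCard.1 hm₂
    have hm₂m : m₂ ≤ m := hm₂.trans (Multiset.filter_le _ _)
    obtain ⟨m₁, rfl⟩ := Multiset.le_iff_exists_add.1 hm₂m
    have h1 : normOn p (shiftAlg n (mixedDiff b m₂) f)
        (box b z₀ (fun _ => 1 / 2) (fun _ => 1 / 2 + η + M * η)) ≤ C₃ * ω := by
      refine hC₃ b z₀ f ω i hf (hω i) _ _ η m₂ hm₂r (fun a ha => ?_)
        (fun a ha => hmη a (Multiset.mem_add.2 (Or.inl ha))) hη0.le (by linarith) (by linarith)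
        (by linarith)
      exact (Multiset.mem_filter.1 (Multiset.mem_of_le hm₂ ha)).2.symm
    rw [Multiset.card_add] at hmM
    have hm₁M : Multiset.card m₁ ≤ M := by omega
    rw [mixedDiff_add, mul_comm, map_mul, Module.End.mul_apply]
    refine (normOn_mixedDiff_le b z₀ m₁ (fun a ha => hmη a (Multiset.mem_add.2 (Or.inr ha)))
      (adm_shiftAlg_mixedDiff b m₂ hf) (1 / 2) (1 / 2 + η) (1 / 2 + η + M * η) ?_).trans ?_
    · have : (Multiset.card m₁ : ℝ) ≤ M := by exact_mod_cast hm₁M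
      gcongr
    · have h2 : (1 : ℝ≥0∞) ≤ 2 * triConst p := by
        have h3 : (1 : ℝ≥0) ≤ 2 * triConst p :=
          one_le_two.trans (le_mul_of_one_le_right' one_le_triConst)
        exact_mod_cast h3
      calc (2 * triConst p : ℝ≥0∞) ^ Multiset.card m₁ * _
          ≤ (2 * triConst p : ℝ≥0∞) ^ M * (C₃ * ω) := mul_le_mul' (pow_le_pow_right₀ h2 hm₁M) h1
        _ = C₄ * ω := by rw [hC₄]; push_cast; ring
  obtain ⟨c, hc⟩ := hC₂ b z₀ (1 / 2) η f (C₄ * ω) hη0 hf (ne_top_of_le_ne_top hfin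
    (normOn_mono_set (box_mono b z₀ (fun _ => by norm_num) fun _ => by linarith))) hsmall
  refine ⟨c, ?_⟩
  have hadm : Adm p (fun x => f x - ∑ β ∈ exponents n r, c β * monomialAt b z₀ β x) :=
    hf.sub (adm_sum _ fun β _ => (adm_monomialAt b z₀ β).const_mul _)
  refine (hC₁ b z₀ _ ω hadm fun i h hh => ?_).trans ?_
  · rw [shiftAlg_pow_sub_one_sub_sum hr]
    exact hω i h hh
  · rw [ENNReal.coe_mul, mul_assoc]
    gcongr
    rw [ENNReal.coe_add, add_mul, ENNReal.coe_one, one_mul, ENNReal.coe_mul, mul_assoc]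
    gcongr

end Extension

/-! ### The approximant as a polynomial of degree less than r in each edge direction -/

section DirectionalPolynomials

variable {n : ℕ} (b : Module.Basis (Fin n) ℝ (EuclideanSpace ℝ (Fin n)))
  (z₀ : EuclideanSpace ℝ (Fin n))

theorem exists_eval_eq_coordAt (i : Fin n) : ∃ Q : MvPolynomial (Fin n) ℝ,
    ∀ z : EuclideanSpace ℝ (Fin n), MvPolynomial.eval z.ofLp Q = coordAt b z₀ i z := by
  refine ⟨∑ k, MvPolynomial.C (b.coord i (EuclideanSpace.single k 1)) * MvPolynomial.X k -
    MvPolynomial.C (b.coord i z₀), fun z => ?_⟩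
  have hz : b.coord i z = ∑ k, b.coord i (EuclideanSpace.single k 1) * z k := by
    conv_lhs => rw [← (EuclideanSpace.basisFun (Fin n) ℝ).sum_repr z]
    rw [map_sum]
    refine Finset.sum_congr rfl fun k _ => ?_
    rw [map_smul, smul_eq_mul, mul_comm]
    simp
  simp only [map_sub, map_sum, map_mul, MvPolynomial.eval_C, MvPolynomial.eval_X]
  rw [← hz, ← map_sub]
  rfl

/-- Combinations of the monomials of degree less than `r` in each coordinate are polynomials of degree
less than `r` in the directions of the basis. -/
theorem exists_mem_dirPoly_eval_eq {r : ℕ} (hr : 1 ≤ r) (c : Multiset (Fin n) → ℝ)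
    {𝓔 : Set (EuclideanSpace ℝ (Fin n))} (h𝓔 : ∀ e ∈ 𝓔, ∃ (i : Fin n) (s : ℝ), e = s • b i) :
    ∃ Q ∈ dirPoly r 𝓔, ∀ z : EuclideanSpace ℝ (Fin n), MvPolynomial.eval z.ofLp Q =
      ∑ β ∈ exponents n r, c β * monomialAt b z₀ β z := by
  choose q hq using exists_eval_eq_coordAt b z₀
  have heval : ∀ z : EuclideanSpace ℝ (Fin n), MvPolynomial.eval z.ofLp
      (∑ β ∈ exponents n r, MvPolynomial.C (c β) * ∏ j, q j ^ β.count j) =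
      ∑ β ∈ exponents n r, c β * monomialAt b z₀ β z := by
    intro z
    simp only [map_sum, map_mul, map_prod, map_pow, MvPolynomial.eval_C, hq, monomialAt]
  refine ⟨_, ?_, heval⟩
  intro x e he
  obtain ⟨i, s, rfl⟩ := h𝓔 e he
  refine ⟨∑ β ∈ exponents n r, Polynomial.C (c β *
    ∏ j ∈ Finset.univ.erase i, coordAt b z₀ j x ^ β.count j) *
      (Polynomial.C s * Polynomial.X + Polynomial.C (coordAt b z₀ i x)) ^ β.count i, ?_, fun t => ?_⟩
  · rw [← Polynomial.mem_degreeLT]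
    refine Submodule.sum_mem _ fun β hβ => ?_
    rw [← Polynomial.smul_eq_C_mul]
    refine Submodule.smul_mem _ _ (Polynomial.mem_degreeLT.2 ?_)
    have h1 := Polynomial.degree_pow_le_of_le (β.count i)
      (Polynomial.degree_linear_le (a := s) (b := coordAt b z₀ i x))
    refine h1.trans_lt ?_
    have h2 := mem_exponents.1 hβ i
    have h3 : β.count i < r := by omega
    rw [mul_one]
    exact_mod_cast h3
  · rw [heval, Polynomial.eval_finsetSum]
    refine Finset.sum_congr rfl fun β _ => ?_
    rw [monomialAt, ← Finset.mul_prod_erase _ _ (Finset.mem_univ i)]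
    have h1 : ∏ j ∈ Finset.univ.erase i, coordAt b z₀ j (x + t • s • b i) ^ β.count j =
        ∏ j ∈ Finset.univ.erase i, coordAt b z₀ j x ^ β.count j := by
      refine Finset.prod_congr rfl fun j hj => ?_
      rw [smul_smul, coordAt_add_smul, if_neg (Finset.ne_of_mem_erase hj).symm, add_zero]
    rw [h1, smul_smul, coordAt_add_smul, if_pos rfl]
    simp only [Polynomial.eval_mul, Polynomial.eval_C, Polynomial.eval_pow, Polynomial.eval_add,
      Polynomial.eval_X]
    ring

theorem convex_box (lo hi : Fin n → ℝ) : Convex ℝ (box b z₀ lo hi) := by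
  intro x hx y hy s t hs ht hst i
  have h : coordAt b z₀ i (s • x + t • y) = s * coordAt b z₀ i x + t * coordAt b z₀ i y := by
    have h1 : s • x + t • y - z₀ = s • (x - z₀) + t • (y - z₀) := by
      have : z₀ = s • z₀ + t • z₀ := by rw [← add_smul, hst, one_smul]
      nth_rw 1 [this]
      module
    simp [coordAt, h1]
  rw [h]
  have h1 := hx i
  have h2 := hy i
  constructor
  · calc lo i = s * lo i + t * lo i := by rw [← add_mul, hst, one_mul]
      _ ≤ _ := by gcongr <;> tauto
  · calc _ ≤ s * hi i + t * hi i := by gcongr <;> tauto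
      _ = hi i := by rw [← add_mul, hst, one_mul]

end DirectionalPolynomials

/-! ### Passage to the moduli, and invariance under changes on null sets -/

section ModulusBounds

variable {n : ℕ} {p : ℝ≥0∞}

/-- Links the operator form to `finDiff`: on A the segments stay in Ω, so the zero branch never
occurs. -/
theorem normOn_le_modulus {r : ℕ} {f : EuclideanSpace ℝ (Fin n) → ℝ}
    {A Ω 𝓔 : Set (EuclideanSpace ℝ (Fin n))} {ξ v : EuclideanSpace ℝ (Fin n)} {u : ℝ}
    (hA : NullMeasurableSet A) (hAΩ : A ⊆ Ω) (hξ : ξ ∈ 𝓔) (hu : u ∈ Ioc 0 (Metric.diam Ω))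
    (hv : u • ξ = v) (hseg : ∀ z ∈ A, segment ℝ z (z + (r : ℝ) • v) ⊆ Ω) :
    normOn p (shiftAlg n ((shift v - 1) ^ r) f) A ≤ modulus r p f Ω 𝓔 := by
  subst hv
  have h1 : normOn p (shiftAlg n ((shift (u • ξ) - 1) ^ r) f) A = normOn p (finDiff r (u • ξ) f Ω) A :=
    normOn_congr hA fun z hz => by
      rw [shiftAlg_pow_sub_one, finDiff, if_pos (hseg z hz)]
  rw [h1]
  refine (normOn_mono_set hAΩ).trans ?_
  exact le_iSup₂_of_le ξ hξ (le_iSup₂_of_le u hu le_rfl)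

theorem nullMeasurableSet_inter_translate {A : Set (EuclideanSpace ℝ (Fin n))}
    (hA : NullMeasurableSet A) (v : EuclideanSpace ℝ (Fin n)) :
    NullMeasurableSet {z | z ∈ A ∧ z + v ∈ A} :=
  hA.inter (hA.preimage (measurePreserving_add_right volume v).quasiMeasurePreserving)

theorem add_smul_mem_segment {r j : ℕ} (hj : j ≤ r) (x ξ : EuclideanSpace ℝ (Fin n)) :
    x + (j : ℝ) • ξ ∈ segment ℝ x (x + (r : ℝ) • ξ) := by
  rw [segment_eq_image']
  rcases Nat.eq_zero_or_pos r with hr | hr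
  · have : j = 0 := by omega
    exact ⟨0, by simp, by simp [this]⟩
  · have hr' : (0 : ℝ) < r := by exact_mod_cast hr
    have hj' : (j : ℝ) ≤ r := by exact_mod_cast hj
    refine ⟨j / r, ⟨by positivity, (div_le_one hr').2 hj'⟩, ?_⟩
    simp only [add_sub_cancel_left]
    rw [smul_smul, div_mul_cancel₀ _ hr'.ne']

/-- A nonzero branch evaluates the function only at points of Ω, and countably many translates of a
null set are null. -/
theorem finDiff_congr_ae {r : ℕ} {f g : EuclideanSpace ℝ (Fin n) → ℝ}
    {Ω : Set (EuclideanSpace ℝ (Fin n))} (hΩ : NullMeasurableSet Ω)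
    (hfg : f =ᵐ[volume.restrict Ω] g) (ξ : EuclideanSpace ℝ (Fin n)) :
    finDiff r ξ f Ω =ᵐ[volume] finDiff r ξ g Ω := by
  have h1 : ∀ᵐ x ∂(volume : Measure (EuclideanSpace ℝ (Fin n))), x ∈ Ω → f x = g x :=
    (ae_restrict_iff'₀ hΩ).1 hfg
  have h2 : ∀ᵐ x ∂(volume : Measure (EuclideanSpace ℝ (Fin n))), ∀ j : ℕ,
      x + (j : ℝ) • ξ ∈ Ω → f (x + (j : ℝ) • ξ) = g (x + (j : ℝ) • ξ) :=
    ae_all_iff.2 fun j =>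
      (measurePreserving_add_right volume ((j : ℝ) • ξ)).quasiMeasurePreserving.ae h1
  filter_upwards [h2] with x hx
  simp only [finDiff]
  split_ifs with hseg
  · refine Finset.sum_congr rfl fun j hj => ?_
    rw [hx j (hseg (add_smul_mem_segment (Nat.lt_succ_iff.1 (Finset.mem_range.1 hj)) x ξ))]
  · rfl

theorem normOn_congr_ae (hp : p ≠ ∞) {f g : EuclideanSpace ℝ (Fin n) → ℝ}
    {Ω : Set (EuclideanSpace ℝ (Fin n))} (hfg : f =ᵐ[volume.restrict Ω] g) :
    normOn p f Ω = normOn p g Ω := by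
  simp only [normOn_of_ne_top hp]
  exact eLpNorm_congr_ae hfg

theorem modulus_congr_ae (hp : p ≠ ∞) {r : ℕ} {f g : EuclideanSpace ℝ (Fin n) → ℝ}
    {Ω 𝓔 : Set (EuclideanSpace ℝ (Fin n))} (hΩ : NullMeasurableSet Ω)
    (hfg : f =ᵐ[volume.restrict Ω] g) : modulus r p f Ω 𝓔 = modulus r p g Ω 𝓔 := by
  simp only [modulus]
  refine iSup_congr fun ξ => iSup_congr fun _ => iSup_congr fun u => iSup_congr fun _ => ?_
  exact normOn_congr_ae hp (ae_restrict_of_ae (finDiff_congr_ae hΩ hfg (u • ξ)))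

theorem bestApprox_congr_ae (hp : p ≠ ∞) {r : ℕ} {f g : EuclideanSpace ℝ (Fin n) → ℝ}
    {Ω 𝓔 : Set (EuclideanSpace ℝ (Fin n))} (hfg : f =ᵐ[volume.restrict Ω] g) :
    bestApprox r p f Ω 𝓔 = bestApprox r p g Ω 𝓔 := by
  simp only [bestApprox]
  refine iInf_congr fun Q => iInf_congr fun _ => normOn_congr_ae hp ?_
  filter_upwards [hfg] with x hx
  rw [hx]

end ModulusBounds

/-! ### Slab coordinates, and the inequality on the region between two graphs -/

section GraphRegion

variable {d : ℕ}

/-- The edge vectors of the part of `{(x, y) : |y - H x| ≤ δ}` over a parallelepiped. -/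
noncomputable def slabEdge (v : Fin d → EuclideanSpace ℝ (Fin d)) (H : EuclideanSpace ℝ (Fin d) →ᵃ[ℝ] ℝ) (δ : ℝ) :
    Fin (d + 1) → EuclideanSpace ℝ (Fin (d + 1)) :=
  Fin.snoc (α := fun _ => EuclideanSpace ℝ (Fin (d + 1)))
    (fun i => pt (v i) (H.linear (v i))) ((2 * δ) • eLast d)

theorem base_add (z w : EuclideanSpace ℝ (Fin (d + 1))) : base (z + w) = base z + base w := rfl

theorem base_smul (t : ℝ) (z : EuclideanSpace ℝ (Fin (d + 1))) : base (t • z) = t • base z := rfl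

theorem base_sum {ι : Type*} (s : Finset ι) (F : ι → EuclideanSpace ℝ (Fin (d + 1))) :
    base (∑ i ∈ s, F i) = ∑ i ∈ s, base (F i) :=
  map_sum (⟨⟨base, rfl⟩, base_add⟩ : EuclideanSpace ℝ (Fin (d + 1)) →+ EuclideanSpace ℝ (Fin d)) F s

theorem height_add (z w : EuclideanSpace ℝ (Fin (d + 1))) :
    height (z + w) = height z + height w := rfl

theorem height_smul (t : ℝ) (z : EuclideanSpace ℝ (Fin (d + 1))) : height (t • z) = t * height z :=
  rfl

theorem height_sum {ι : Type*} (s : Finset ι) (F : ι → EuclideanSpace ℝ (Fin (d + 1))) :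
    height (∑ i ∈ s, F i) = ∑ i ∈ s, height (F i) :=
  map_sum (⟨⟨height, rfl⟩, height_add⟩ : EuclideanSpace ℝ (Fin (d + 1)) →+ ℝ) F s

theorem base_pt (x : EuclideanSpace ℝ (Fin d)) (y : ℝ) : base (pt x y) = x := by
  ext i
  simp [base, pt]

theorem height_pt (x : EuclideanSpace ℝ (Fin d)) (y : ℝ) : height (pt x y) = y := by
  simp [height, pt]

theorem base_eLast : base (eLast d) = 0 := by
  ext i
  simp [base, eLast]

theorem height_eLast : height (eLast d) = 1 := by
  simp [height, eLast]

variable {v : Fin d → EuclideanSpace ℝ (Fin d)} {H : EuclideanSpace ℝ (Fin d) →ᵃ[ℝ] ℝ} {δ : ℝ}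

theorem slabEdge_castSucc (i : Fin d) :
    slabEdge v H δ i.castSucc = pt (v i) (H.linear (v i)) := by
  simp [slabEdge]

theorem slabEdge_last : slabEdge v H δ (Fin.last d) = (2 * δ) • eLast d := by
  simp [slabEdge]

theorem linearIndependent_slabEdge (hv : LinearIndependent ℝ v) (hδ : 0 < δ) :
    LinearIndependent ℝ (slabEdge v H δ) := by
  rw [Fintype.linearIndependent_iff] at hv ⊢
  intro t ht
  rw [Fin.sum_univ_castSucc] at ht
  simp only [slabEdge_castSucc, slabEdge_last] at ht
  have h1 := congrArg base ht
  rw [base_add, base_sum] at h1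
  simp only [base_smul, base_pt, base_eLast, smul_zero, add_zero] at h1
  have h2 := hv (fun i => t i.castSucc) h1
  have h3 := congrArg height ht
  rw [height_add, height_sum] at h3
  simp only [height_smul, h2, zero_mul, Finset.sum_const_zero, zero_add, height_eLast] at h3
  have h4 : t (Fin.last d) = 0 := by
    have h5 : t (Fin.last d) * (2 * δ * 1) = 0 := h3
    rcases mul_eq_zero.1 h5 with h | h
    · exact h
    · linarith
  exact Fin.lastCases h4 h2

variable {x₀ : EuclideanSpace ℝ (Fin d)}
  {b : Module.Basis (Fin (d + 1)) ℝ (EuclideanSpace ℝ (Fin (d + 1)))}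

theorem base_eq (hb : ∀ i, b i = slabEdge v H δ i) (z : EuclideanSpace ℝ (Fin (d + 1))) :
    base z = x₀ + ∑ i : Fin d, coordAt b (pt x₀ (H x₀ - δ)) i.castSucc z • v i := by
  conv_lhs => rw [eq_add_sum_coordAt b (pt x₀ (H x₀ - δ)) z]
  rw [base_add, base_sum, base_pt, Fin.sum_univ_castSucc]
  simp only [hb, slabEdge_castSucc, slabEdge_last, base_smul, base_pt, base_eLast, smul_zero,
    add_zero]

/-- The origin lies on the lower face, so the last coordinate is 0 on the graph of H - δ and 1 on
that of H + δ. -/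
theorem height_eq (hb : ∀ i, b i = slabEdge v H δ i) (z : EuclideanSpace ℝ (Fin (d + 1))) :
    height z = H (base z) - δ + 2 * δ * coordAt b (pt x₀ (H x₀ - δ)) (Fin.last d) z := by
  conv_lhs => rw [eq_add_sum_coordAt b (pt x₀ (H x₀ - δ)) z]
  rw [height_add, height_sum, height_pt, Fin.sum_univ_castSucc, base_eq (x₀ := x₀) hb z]
  simp only [hb, slabEdge_castSucc, slabEdge_last, height_smul, height_pt, height_eLast]
  have : H (x₀ + ∑ i : Fin d, coordAt b (pt x₀ (H x₀ - δ)) i.castSucc z • v i) =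
      H.linear (∑ i : Fin d, coordAt b (pt x₀ (H x₀ - δ)) i.castSucc z • v i) + H x₀ := by
    rw [add_comm x₀]
    exact H.map_vadd x₀ _
  rw [this, map_sum]
  simp only [map_smul, smul_eq_mul]
  ring

theorem base_mem_pped_iff (hv : LinearIndependent ℝ v) (hb : ∀ i, b i = slabEdge v H δ i)
    (z : EuclideanSpace ℝ (Fin (d + 1))) : base z ∈ pped x₀ v ↔
      ∀ i : Fin d, 0 ≤ coordAt b (pt x₀ (H x₀ - δ)) i.castSucc z ∧
        coordAt b (pt x₀ (H x₀ - δ)) i.castSucc z ≤ 1 := by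
  constructor
  · rintro ⟨y, hy, hyz⟩
    obtain ⟨t, ht, rfl⟩ := (mem_parallelepiped_iff v y).1 hy
    dsimp only at hyz
    rw [base_eq (x₀ := x₀) hb z, add_right_inj] at hyz
    intro i
    have h1 : ∑ i : Fin d, (t i - coordAt b (pt x₀ (H x₀ - δ)) i.castSucc z) • v i = 0 := by
      simp only [sub_smul, Finset.sum_sub_distrib, hyz, sub_self]
    have h2 := Fintype.linearIndependent_iff.1 hv _ h1 i
    rw [← sub_eq_zero.1 h2]
    exact ⟨ht.1 i, ht.2 i⟩
  · intro h
    refine ⟨_, (mem_parallelepiped_iff v _).2 ⟨fun i => coordAt b (pt x₀ (H x₀ - δ)) i.castSucc z,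
      ⟨fun i => (h i).1, fun i => (h i).2⟩, rfl⟩, ?_⟩
    exact (base_eq (x₀ := x₀) hb z).symm

theorem graphRegion_slab_eq_box (hv : LinearIndependent ℝ v) (hδ : 0 < δ)
    (hb : ∀ i, b i = slabEdge v H δ i) :
    graphRegion (pped x₀ v) (fun x => H x - δ) (fun x => H x + δ) =
      box b (pt x₀ (H x₀ - δ)) (fun _ => 0) (fun _ => 1) := by
  ext z
  have h1 := height_eq (x₀ := x₀) hb z
  change (base z ∈ pped x₀ v ∧ H (base z) - δ ≤ height z ∧ height z ≤ H (base z) + δ) ↔ _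
  rw [base_mem_pped_iff hv hb]
  constructor
  · rintro ⟨h2, h3, h4⟩
    refine Fin.lastCases ⟨?_, ?_⟩ h2
    · by_contra h
      nlinarith
    · by_contra h
      nlinarith
  · intro h
    have h2 := h (Fin.last d)
    refine ⟨fun i => h i.castSucc, ?_, ?_⟩ <;> nlinarith [h2.1, h2.2]

theorem exists_basis_eq_slabEdge (hv : LinearIndependent ℝ v) (hδ : 0 < δ) :
    ∃ b : Module.Basis (Fin (d + 1)) ℝ (EuclideanSpace ℝ (Fin (d + 1))),
      ∀ i, b i = slabEdge v H δ i :=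
  ⟨basisOfLinearIndependentOfCardEqFinrank (linearIndependent_slabEdge (H := H) hv hδ) (by simp),
    fun i => by simp⟩

theorem nullMeasurableSet_slab (x₀ : EuclideanSpace ℝ (Fin d)) (hv : LinearIndependent ℝ v)
    (hδ : 0 < δ) :
    NullMeasurableSet (graphRegion (pped x₀ v) (fun x => H x - δ) (fun x => H x + δ)) := by
  obtain ⟨b, hb⟩ := exists_basis_eq_slabEdge (H := H) hv hδ
  rw [graphRegion_slab_eq_box hv hδ hb]
  exact (measurableSet_box _ _ _ _).nullMeasurableSet

/-- The inequality for functions to which the quasi-triangle inequality applies. -/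
theorem exists_bestApprox_graphRegion_le (d r : ℕ) (hr : 1 ≤ r) {p : ℝ≥0∞} (hp : 0 < p) (L : ℝ) :
    ∃ C : ℝ≥0,
      ∀ (x₀ : EuclideanSpace ℝ (Fin d)) (v : Fin d → EuclideanSpace ℝ (Fin d)),
        LinearIndependent ℝ v →
      ∀ (g₁ g₂ : EuclideanSpace ℝ (Fin d) → ℝ) (H : EuclideanSpace ℝ (Fin d) →ᵃ[ℝ] ℝ) (δ : ℝ),
        0 < δ →
        NullMeasurableSet (graphRegion (pped x₀ v) g₁ g₂) volume →
        (∀ x ∈ pped x₀ v, δ ≤ H x - g₁ x ∧ H x - g₁ x ≤ L * δ) →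
        (∀ x ∈ pped x₀ v, δ ≤ g₂ x - H x ∧ g₂ x - H x ≤ L * δ) →
      ∀ f : EuclideanSpace ℝ (Fin (d + 1)) → ℝ, Adm p f →
        MemLpOn p f (graphRegion (pped x₀ v) g₁ g₂) →
        bestApprox r p f (graphRegion (pped x₀ v) g₁ g₂) (edgeDirections v H ∪ {eLast d}) ≤
          C * (modulus r p f (graphRegion (pped x₀ v) (fun x => H x - δ) (fun x => H x + δ))
                (edgeDirections v H) +
              modulus r p f (graphRegion (pped x₀ v) g₁ g₂) {eLast d}) := by
  have hr' : (0 : ℝ) < r := by exact_mod_cast hr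
  obtain ⟨Cw, hCw⟩ := exists_normOn_unit_box_sub_le (n := d + 1) hp r hr
  -- With τ the last slab coordinate, S is given over D by |τ - 1/2| ≤ 1/2 and G lies in |τ - 1/2| ≤
  -- L/2; r steps of size 1/r span exactly the height of S.
  obtain ⟨Cs, hCs⟩ := normOn_le_slab (n := d + 1) (p := p) r (1 / 2) (1 / r) (L / 2) (by norm_num)
    (by positivity) (by rw [mul_one_div_cancel hr'.ne']; norm_num)
  refine ⟨Cs * (Cw + 1), fun x₀ v hv g₁ g₂ H δ hδ hG hg₁ hg₂ f hf hfG => ?_⟩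
  set z₀ := pt x₀ (H x₀ - δ) with hz₀
  obtain ⟨b, hb⟩ := exists_basis_eq_slabEdge (H := H) hv hδ
  have hbl : b (Fin.last d) = (2 * δ) • eLast d := by rw [hb, slabEdge_last]
  rw [graphRegion_slab_eq_box hv hδ hb, ← hz₀]
  set K := box b z₀ (fun _ => 0) (fun _ => 1) with hK
  set G := graphRegion (pped x₀ v) g₁ g₂ with hGdef
  set τ := coordAt b z₀ (Fin.last d) with hτ
  have hheight : ∀ z, height z = H (base z) - δ + 2 * δ * τ z := height_eq hb
  have hKmem : ∀ z, z ∈ K ↔ base z ∈ pped x₀ v ∧ 0 ≤ τ z ∧ τ z ≤ 1 := by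
    intro z
    rw [base_mem_pped_iff hv hb]
    exact ⟨fun h => ⟨fun i => h i.castSucc, h (Fin.last d)⟩, fun h => Fin.lastCases h.2 h.1⟩
  have hGmem : ∀ z, z ∈ G ↔ base z ∈ pped x₀ v ∧ g₁ (base z) ≤ height z ∧ height z ≤ g₂ (base z) :=
    fun z => Iff.rfl
  have hKG : K ⊆ G := by
    intro z hz
    obtain ⟨h1, h2, h3⟩ := (hKmem z).1 hz
    have h4 := hg₁ _ h1
    have h5 := hg₂ _ h1
    refine (hGmem z).2 ⟨h1, ?_, ?_⟩ <;> rw [hheight] <;> nlinarith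
  have hGτ : ∀ z ∈ G, |τ z - 1 / 2| ≤ L / 2 := by
    intro z hz
    obtain ⟨h1, h2, h3⟩ := (hGmem z).1 hz
    have h4 := hg₁ _ h1
    have h5 := hg₂ _ h1
    rw [hheight] at h2 h3
    rw [abs_le]
    constructor
    · by_contra h
      nlinarith
    · by_contra h
      nlinarith
  have hbaseadd : ∀ z (t : ℝ), base (z + t • b (Fin.last d)) = base z := by
    intro z t
    rw [base_add, hbl, base_smul, base_smul, base_eLast, smul_zero, smul_zero, add_zero]
  have hheightadd : ∀ z (t : ℝ), height (z + t • b (Fin.last d)) = height z + t * (2 * δ) := by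
    intro z t
    rw [height_add, hbl, height_smul, height_smul, height_eLast, mul_one]
  have hτadd : ∀ z (t : ℝ), τ (z + t • b (Fin.last d)) = τ z + t := by
    intro z t
    rw [hτ, coordAt_add_smul, if_pos rfl]
  have hGfib : ∀ z ∈ G, ∀ t : ℝ, |τ z + t - 1 / 2| ≤ 1 / 2 → z + t • b (Fin.last d) ∈ G := by
    intro z hz t ht
    refine hKG ((hKmem _).2 ⟨?_, ?_⟩)
    · rw [hbaseadd]
      exact ((hGmem z).1 hz).1
    · rw [hτadd]
      rw [abs_le] at ht
      constructor <;> linarith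
  have hGconv : ∀ z ∈ G, ∀ t : ℝ, z + t • b (Fin.last d) ∈ G →
      ∀ s ∈ uIcc 0 t, z + s • b (Fin.last d) ∈ G := by
    intro z hz t ht s hs
    rw [hGmem] at hz ht ⊢
    rw [hbaseadd, hheightadd] at ht ⊢
    refine ⟨hz.1, ?_⟩
    rw [mem_uIcc] at hs
    rcases hs with hs | hs
    · constructor <;> nlinarith [hz.2.1, hz.2.2, ht.2.1, ht.2.2]
    · constructor <;> nlinarith [hz.2.1, hz.2.2, ht.2.1, ht.2.2]
  have hz₀K : z₀ ∈ K := fun i => by simp [coordAt]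
  have hzbK : ∀ i, z₀ + b i ∈ K := by
    intro i j
    have := coordAt_add_smul b z₀ j i z₀ 1
    rw [one_smul] at this
    rw [this]
    simp only [coordAt, sub_self, map_zero, Finsupp.coe_zero, Pi.zero_apply, zero_add]
    split_ifs <;> norm_num
  -- K contains both ends of an edge in each direction, so lengths h‖b i‖ with h ≤ 1 are admissible
  -- in the moduli, where u ≤ diam Ω.
  have hnorm_le : ∀ (i) (Ω : Set (EuclideanSpace ℝ (Fin (d + 1)))), K ⊆ Ω → Bornology.IsBounded Ω →
      ‖b i‖ ≤ Metric.diam Ω := by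
    intro i Ω hΩ hΩb
    have := Metric.dist_le_diam_of_mem hΩb (hΩ (hzbK i)) (hΩ hz₀K)
    simpa [dist_eq_norm] using this
  have hKb : Bornology.IsBounded K := (isCompact_box b z₀ _ _).isBounded
  have hGb : Bornology.IsBounded G := by
    refine (isCompact_box b z₀ (Fin.snoc (α := fun _ => ℝ) (fun _ => 0) (1 / 2 - L / 2))
      (Fin.snoc (α := fun _ => ℝ) (fun _ => 1) (1 / 2 + L / 2))).isBounded.subset fun z hz => ?_
    refine Fin.lastCases ?_ fun i => ?_
    · have := hGτ z hz
      rw [abs_le] at this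
      simp only [Fin.snoc_last]
      constructor <;> linarith
    · simp only [Fin.snoc_castSucc]
      exact (base_mem_pped_iff hv hb z).1 ((hGmem z).1 hz).1 i
  have hbpos : ∀ i, 0 < ‖b i‖ := fun i => norm_pos_iff.2 (b.ne_zero i)
  have hnorml : ‖b (Fin.last d)‖ = 2 * δ := by
    rw [hbl, norm_smul, Real.norm_of_nonneg (by positivity)]
    simp [eLast]
  set ω₁ := modulus r p f K (edgeDirections v H) with hω₁
  set ω₂ := modulus r p f G {eLast d} with hω₂
  have hlast : ∀ (A : Set (EuclideanSpace ℝ (Fin (d + 1)))), NullMeasurableSet A → A ⊆ G →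
      ∀ h ∈ Ioc (0 : ℝ) 1,
      (∀ z ∈ A, segment ℝ z (z + (r : ℝ) • h • b (Fin.last d)) ⊆ G) →
      normOn p (shiftAlg (d + 1) ((shift (h • b (Fin.last d)) - 1) ^ r) f) A ≤ ω₂ := by
    intro A hA hAG h hh hseg
    refine normOn_le_modulus (ξ := eLast d) (u := h * (2 * δ)) hA hAG rfl
      ⟨mul_pos hh.1 (by positivity), ?_⟩ (by rw [hbl, smul_smul]) hseg
    refine le_trans ?_ (hnorm_le (Fin.last d) G hKG hGb)
    rw [hnorml]
    exact mul_le_of_le_one_left (by positivity) hh.2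
  have hωK : ∀ i, ∀ h ∈ Ioc (0 : ℝ) 1,
      normOn p (shiftAlg (d + 1) ((shift (h • b i) - 1) ^ r) f)
        {z | z ∈ K ∧ z + (r * h) • b i ∈ K} ≤ ω₁ + ω₂ := by
    intro i h hh
    have hA : NullMeasurableSet {z | z ∈ K ∧ z + (r * h) • b i ∈ K} :=
      nullMeasurableSet_inter_translate (measurableSet_box b z₀ _ _).nullMeasurableSet _
    have hseg : ∀ z ∈ {z | z ∈ K ∧ z + (r * h) • b i ∈ K},
        segment ℝ z (z + (r : ℝ) • h • b i) ⊆ K := by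
      rintro z ⟨h1, h2⟩
      rw [smul_smul]
      exact (convex_box b z₀ _ _).segment_subset h1 h2
    revert hA hseg
    refine Fin.lastCases (fun hA hseg => ?_) (fun j hA hseg => ?_) i
    · exact (hlast _ hA (fun z hz => hKG hz.1) h hh
        fun z hz => (hseg z hz).trans hKG).trans le_add_self
    · have hdir : ‖b j.castSucc‖⁻¹ • b j.castSucc ∈ edgeDirections v H :=
        ⟨j, by simp only [hb, slabEdge_castSucc]⟩
      refine (normOn_le_modulus (u := h * ‖b j.castSucc‖) hA (fun z hz => hz.1) hdir
        ⟨mul_pos hh.1 (hbpos _), ?_⟩ ?_ hseg).trans le_self_add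
      · exact (mul_le_of_le_one_left (norm_nonneg _) hh.2).trans
          (hnorm_le j.castSucc K subset_rfl hKb)
      · rw [smul_smul, mul_assoc, mul_inv_cancel₀ (hbpos _).ne', mul_one]
  have hfin : normOn p f K ≠ ∞ := by
    by_cases hpt : p = ∞
    · rw [MemLpOn, if_pos hpt] at hfG
      exact normOn_box_ne_top_of_continuous b z₀ _ _ (hfG.mono hKG)
    · rw [MemLpOn, if_neg hpt] at hfG
      refine ne_top_of_le_ne_top ?_ (normOn_mono_set hKG)
      rw [normOn_of_ne_top hpt]
      exact hfG.2.ne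
  obtain ⟨c, hc⟩ := hCw b z₀ f (ω₁ + ω₂) hf hfin hωK
  set F : EuclideanSpace ℝ (Fin (d + 1)) → ℝ :=
    fun x => f x - ∑ β ∈ exponents (d + 1) r, c β * monomialAt b z₀ β x with hFdef
  have hF : Adm p F := hf.sub (adm_sum _ fun β _ => (adm_monomialAt b z₀ β).const_mul _)
  have hωG : normOn p (shiftAlg (d + 1) ((shift ((1 / r : ℝ) • b (Fin.last d)) - 1) ^ r) F)
      {z | z ∈ G ∧ z + (r * (1 / r : ℝ)) • b (Fin.last d) ∈ G} ≤ ω₁ + ω₂ := by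
    rw [hFdef, shiftAlg_pow_sub_one_sub_sum hr]
    refine (hlast _ ?_ (fun z hz => hz.1) _ ⟨by positivity, ?_⟩ ?_).trans le_add_self
    · exact nullMeasurableSet_inter_translate hG _
    · rw [div_le_one hr']
      exact_mod_cast hr
    · rintro z ⟨h1, h2⟩ y hy
      rw [smul_smul, segment_eq_image'] at hy
      obtain ⟨θ, hθ, rfl⟩ := hy
      simp only [add_sub_cancel_left]
      rw [smul_smul]
      -- Vertical fibres of G are intervals, so a vertical segment with both ends in G stays in G.
      refine hGconv z h1 _ h2 _ ?_
      have h3 : (0 : ℝ) ≤ r * (1 / r) := by positivity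
      rw [uIcc_of_le h3]
      exact ⟨mul_nonneg hθ.1 h3, mul_le_of_le_one_left h3 hθ.2⟩
  have hslab := hCs b z₀ (Fin.last d) G (1 / 2) F (ω₁ + ω₂) hF hGτ hGfib hGconv hωG
  have hsub : {z | z ∈ G ∧ |coordAt b z₀ (Fin.last d) z - 1 / 2| ≤ 1 / 2} ⊆ K := by
    rintro z ⟨h1, h2⟩
    rw [abs_le] at h2
    exact (hKmem z).2 ⟨((hGmem z).1 h1).1, by linarith, by linarith⟩
  obtain ⟨Q, hQ, hQeval⟩ := exists_mem_dirPoly_eval_eq b z₀ hr c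
    (𝓔 := edgeDirections v H ∪ {eLast d}) (by
      rintro e (⟨i, rfl⟩ | he)
      · exact ⟨i.castSucc, _, by rw [hb, slabEdge_castSucc]⟩
      · rw [mem_singleton_iff] at he
        subst he
        exact ⟨Fin.last d, (2 * δ)⁻¹, by
          rw [hbl, smul_smul, inv_mul_cancel₀ (by positivity), one_smul]⟩)
  refine (iInf₂_le Q hQ).trans ?_
  simp only [hQeval]
  refine hslab.trans ?_
  rw [ENNReal.coe_mul, mul_assoc]
  gcongr
  rw [ENNReal.coe_add, add_mul, ENNReal.coe_one, one_mul]
  exact add_le_add ((normOn_mono_set hsub).trans hc) le_rfl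

end GraphRegion

end GraphWhitney

theorem mainTheorem10 (d r : ℕ) (hd : 1 ≤ d) (hr : 1 ≤ r) (p : ℝ≥0∞) (hp : 0 < p)
    (L : ℝ) (hL : 1 < L) :
    ∃ C : ℝ≥0,
      ∀ (x₀ : EuclideanSpace ℝ (Fin d)) (v : Fin d → EuclideanSpace ℝ (Fin d)),
        LinearIndependent ℝ v →
      ∀ (g₁ g₂ : EuclideanSpace ℝ (Fin d) → ℝ) (H : EuclideanSpace ℝ (Fin d) →ᵃ[ℝ] ℝ) (δ : ℝ),
        0 < δ →
        NullMeasurableSet (GraphWhitney.graphRegion (GraphWhitney.pped x₀ v) g₁ g₂) volume →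
        (∀ x ∈ GraphWhitney.pped x₀ v, δ ≤ H x - g₁ x ∧ H x - g₁ x ≤ L * δ) →
        (∀ x ∈ GraphWhitney.pped x₀ v, δ ≤ g₂ x - H x ∧ g₂ x - H x ≤ L * δ) →
      ∀ f : EuclideanSpace ℝ (Fin (d + 1)) → ℝ,
        GraphWhitney.MemLpOn p f (GraphWhitney.graphRegion (GraphWhitney.pped x₀ v) g₁ g₂) →
        GraphWhitney.bestApprox r p f
            (GraphWhitney.graphRegion (GraphWhitney.pped x₀ v) g₁ g₂)
            (GraphWhitney.edgeDirections v H ∪ {GraphWhitney.eLast d}) ≤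
          C * (GraphWhitney.modulus r p f
                (GraphWhitney.graphRegion (GraphWhitney.pped x₀ v)
                  (fun x => H x - δ) (fun x => H x + δ))
                (GraphWhitney.edgeDirections v H) +
              GraphWhitney.modulus r p f
                (GraphWhitney.graphRegion (GraphWhitney.pped x₀ v) g₁ g₂)
                {GraphWhitney.eLast d}) := by
  obtain ⟨C, hC⟩ := GraphWhitney.exists_bestApprox_graphRegion_le d r hr hp L
  refine ⟨C, fun x₀ v hv g₁ g₂ H δ hδ hG hg₁ hg₂ f hf => ?_⟩
  by_cases hpt : p = ∞
  -- For p = ∞ the norm is a pointwise supremum, which needs no measurability of f outside G.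
  · exact hC x₀ v hv g₁ g₂ H δ hδ hG hg₁ hg₂ f (Or.inl hpt) hf
  have hf' := hf
  rw [GraphWhitney.MemLpOn, if_neg hpt] at hf'
  -- For p < ∞, f is only almost everywhere measurable on G. A globally measurable representative
  -- has measurable translates, and both sides of the inequality depend only on the class of f on G.
  obtain ⟨g, hg, hfg⟩ := hf'.1
  have hgmem : GraphWhitney.MemLpOn p g (GraphWhitney.graphRegion (GraphWhitney.pped x₀ v) g₁ g₂) := by
    rw [GraphWhitney.MemLpOn, if_neg hpt]
    exact (memLp_congr_ae hfg).1 hf'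
  have hSG : GraphWhitney.graphRegion (GraphWhitney.pped x₀ v) (fun x => H x - δ) (fun x => H x + δ) ⊆
      GraphWhitney.graphRegion (GraphWhitney.pped x₀ v) g₁ g₂ := fun z hz =>
    ⟨hz.1, by linarith [hz.2.1, (hg₁ _ hz.1).1], by linarith [hz.2.2, (hg₂ _ hz.1).1]⟩
  rw [GraphWhitney.bestApprox_congr_ae hpt hfg, GraphWhitney.modulus_congr_ae hpt hG hfg,
    GraphWhitney.modulus_congr_ae hpt (GraphWhitney.nullMeasurableSet_slab x₀ hv hδ)
      (ae_restrict_of_ae_restrict_of_subset hSG hfg)]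
  exact hC x₀ v hv g₁ g₂ H δ hδ hG hg₁ hg₂ g (Or.inr hg.measurable) hgmem
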